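/- Let $\varphi:\mathbb R^d\to\mathbb R$ be $K$-Lipschitz and $\lambda$-concave for some $\lambda\ge 0$, i.e. $y\mapsto\varphi(y)-\frac\lambda2|y|^2$ is concave. Write $\mathcal L$ (also $|\cdot|$) for Lebesgue measure, $f^*(x)=\sup_y\,(x\cdot y-f(y))$ for the Legendre transform, and $\partial f(x)=\{q: f(z)\ge f(x)+q\cdot(z-x)\ \forall z\}$ for the subgradient. For $\varepsilon,t>0$ let $$u^\varepsilon_t(x)=-\varepsilon\log\Big[(2\pi\varepsilon t)^{-d/2}\int_{\mathbb R^d}\exp\Big(-\frac{|x-y|^2}{2\varepsilon t}-\frac{\varphi(y)}{\varepsilon}\Big)\,dy\Big]$$ be the Cole–Hopf solution of $\partial_tu+\frac12|\nabla u|^2=\frac\varepsilon2\Delta u$, $u|_{t=0}=\varphi$, and let $X^\varepsilon$ be its Lagrangian flow: $X^\varepsilon(y,0)=y$, $\partial_tX^\varepsilon(y,t)=\nabla u^\varepsilon_t(X^\varepsilon(y,t))$ for $t>0$, with $t\mapsto X^\varepsilon(y,t)$ continuous on $[0,\infty)$. Then the limit $X_t(y)=\lim_{\varepsilon\to0^+}X^\varepsilon(y,t)$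 exists for all $y\in\mathbb R^d$, $t\ge0$. For $t\ge0$ put $\psi_t(y)=\frac12|y|^2+t\varphi(y)$, $w_t=\psi_t^*$ and $T_t=\nabla\psi_t^{**}$. For $t>0$ let $\Sigma_t$ be the set of $y$ at which $\psi_t^{**}$ is strictly convex, i.e. for which there is $x\in\partial\psi_t^{**}(y)$ such that $z\mapsto\psi_t^{**}(z)-x\cdot z$ has a strict minimum at $y$. Let $\rho_t=(X_t)_\sharp\mathcal L$, and let $\mu_t$ be the Monge–Ampère measure of $w_t$: $\mu_t(B)=|\partial w_t(B)|$ for Borel $B\subset\mathbb R^d$. Let $t>0$. Then $\psi_t^{**}$ is differentiable everywhere, $X_t$ is Borel measurable, $w_t$ is strictly convex, and $\mu_t$ is a Borel measure. Moreover: 1. For a.e. $x\in\mathbb R^d$ there is $y\in\Sigma_t$ such that $X_t^{-1}(x)=T_t^{-1}(x)=\{y\}$, $\varphi$ is differentiable at $y$, and $$X_s(y)=T_s(y)=y+s\nabla\varphi(y)\qquad\text{for } 0\le s\le t.$$ 2. $\rho_t$ and $\mu_t$ have Lebesgue decompositions with respect to $\mathcal L$, and their absolutely continuous parts agree: $\rho_t^{\rm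 ac}=\mu_t^{\rm ac}$. 3. The density of $\rho_t^{\rm ac}=\mu_t^{\rm ac}$ equals $\det\nabla^2w_t$ Lebesgue-a.e. Here $\nabla^2w_t$ is the Hessian in the sense of Alexandrov, which exists a.e.: $w_t$ is differentiable at $x$, $\nabla^2w_t(x)$ is a symmetric matrix, and $$w_t(x+h)=w_t(x)+\nabla w_t(x)\cdot h+\tfrac12h\cdot\nabla^2w_t(x)h+o(|h|^2)\qquad\text{as } h\to0.$$ -/

import Mathlib

open MeasureTheory Filter Topology Set
open scoped NNReal ENNReal Gradient RealInnerProductSpace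

noncomputable section

namespace Adhesion

/-- `φ` is `lam`-concave: `y ↦ φ y - (lam/2)|y|²` is concave. -/
def IsLambdaConcave {d : ℕ} (lam : ℝ) (φ : EuclideanSpace ℝ (Fin d) → ℝ) : Prop :=
  ConcaveOn ℝ univ (fun y => φ y - lam / 2 * ‖y‖ ^ 2)

/-! ### Convex analysis -/

/-- Legendre transform `f^*(x) = sup_y (x·y - f y)`. It is used only where the supremum is finite:
for `f = ψ_t` with `φ` Lipschitz and `t ≥ 0`, and for `f = ψ_t^*`. -/
def legendre {d : ℕ} (f : EuclideanSpace ℝ (Fin d) → ℝ) (x : EuclideanSpace ℝ (Fin d)) : ℝ :=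
  ⨆ y : EuclideanSpace ℝ (Fin d), (⟪x, y⟫ - f y)

/-- The subgradient `∂f(x)` of `f` at `x`. -/
def subgradient {d : ℕ} (f : EuclideanSpace ℝ (Fin d) → ℝ) (x : EuclideanSpace ℝ (Fin d)) :
    Set (EuclideanSpace ℝ (Fin d)) :=
  {q | ∀ z, f x + ⟪q, z - x⟫ ≤ f z}

/-- `g` is strictly convex at `y`: for some `x ∈ ∂g(y)`, the function `z ↦ g z - x·z` has a strict
minimum at `y`. -/
def StrictlyConvexAt {d : ℕ} (g : EuclideanSpace ℝ (Fin d) → ℝ)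
    (y : EuclideanSpace ℝ (Fin d)) : Prop :=
  ∃ x ∈ subgradient g y, ∀ z, z ≠ y → g y - ⟪x, y⟫ < g z - ⟪x, z⟫

/-- `H` is the Hessian of `f` at `x` in the sense of Alexandrov: `H` is symmetric, `f` is
differentiable at `x`, and `f` has the second-order expansion given by `∇f(x)` and `H`. -/
def HasAlexandrovHessianAt {d : ℕ} (f : EuclideanSpace ℝ (Fin d) → ℝ)
    (H : Matrix (Fin d) (Fin d) ℝ) (x : EuclideanSpace ℝ (Fin d)) : Prop :=
  H.IsSymm ∧ DifferentiableAt ℝ f x ∧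
    (fun h : EuclideanSpace ℝ (Fin d) =>
      f (x + h) - f x - ⟪∇ f x, h⟫ - 1 / 2 * ⟪h, Matrix.toEuclideanLin H h⟫)
      =o[𝓝 0] (fun h => ‖h‖ ^ 2)

/-- `μ` is the Monge–Ampère measure of `w`: `μ(B) = |∂w(B)|` for every Borel set `B`. This
determines `μ`. -/
def IsMongeAmpereMeasure {d : ℕ} (w : EuclideanSpace ℝ (Fin d) → ℝ)
    (μ : Measure (EuclideanSpace ℝ (Fin d))) : Prop :=
  ∀ B, MeasurableSet B → μ B = volume (⋃ x ∈ B, subgradient w x)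

/-! ### Convexified transport -/

/-- The free streaming potential `ψ_t(y) = |y|²/2 + t φ(y)`. -/
def psi {d : ℕ} (φ : EuclideanSpace ℝ (Fin d) → ℝ) (t : ℝ) (y : EuclideanSpace ℝ (Fin d)) : ℝ :=
  1 / 2 * ‖y‖ ^ 2 + t * φ y

/-- `w_t = ψ_t^*`. -/
def w {d : ℕ} (φ : EuclideanSpace ℝ (Fin d) → ℝ) (t : ℝ) : EuclideanSpace ℝ (Fin d) → ℝ :=
  legendre (psi φ t)

/-- The convexified potential `ψ_t^{**} = w_t^*`. -/
def psiConv {d : ℕ} (φ : EuclideanSpace ℝ (Fin d) → ℝ) (t : ℝ) : EuclideanSpace ℝ (Fin d) → ℝ :=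
  legendre (w φ t)

/-- The convexified transport map `T_t = ∇ψ_t^{**}`. -/
def T {d : ℕ} (φ : EuclideanSpace ℝ (Fin d) → ℝ) (t : ℝ) :
    EuclideanSpace ℝ (Fin d) → EuclideanSpace ℝ (Fin d) :=
  ∇ (psiConv φ t)

/-- `Σ_t`, the set of points at which `ψ_t^{**}` is strictly convex. -/
def Sigma {d : ℕ} (φ : EuclideanSpace ℝ (Fin d) → ℝ) (t : ℝ) : Set (EuclideanSpace ℝ (Fin d)) :=
  {y | StrictlyConvexAt (psiConv φ t) y}

/-! ### Lagrangian flow of the adhesion model -/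

/-- The Cole–Hopf solution `u^ε_t` (`ε, t > 0`) of
`∂_t u + |∇u|²/2 = (ε/2) Δu`, `u(·, 0) = φ`. -/
def viscousPotential {d : ℕ} (φ : EuclideanSpace ℝ (Fin d) → ℝ) (ε t : ℝ)
    (x : EuclideanSpace ℝ (Fin d)) : ℝ :=
  -ε * Real.log ((2 * Real.pi * ε * t) ^ (-(d : ℝ) / 2) *
    ∫ y : EuclideanSpace ℝ (Fin d), Real.exp (-‖x - y‖ ^ 2 / (2 * ε * t) - φ y / ε))

/-- `Z t y = X^ε(y, t)` is the Lagrangian flow of the velocity field `v^ε = ∇u^ε`: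
`X^ε(y, 0) = y` and `∂_t X^ε(y, t) = v^ε(X^ε(y, t), t)` for `t > 0`, with `t ↦ X^ε(y, t)` continuous
at the initial time. -/
def IsViscousFlow {d : ℕ} (φ : EuclideanSpace ℝ (Fin d) → ℝ) (ε : ℝ)
    (Z : ℝ → EuclideanSpace ℝ (Fin d) → EuclideanSpace ℝ (Fin d)) : Prop :=
  ∀ y, Z 0 y = y ∧ ContinuousWithinAt (fun t => Z t y) (Ici 0) 0 ∧
    ∀ t, 0 < t → HasDerivAt (fun s => Z s y) (∇ (viscousPotential φ ε t) (Z t y)) t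

/-- `X t y = X_t(y)` is the zero-viscosity limit `lim_{ε → 0+} X^ε(y, t)`, for all `y` and
all `t ≥ 0`. -/
def IsAdhesionFlow {d : ℕ} (φ : EuclideanSpace ℝ (Fin d) → ℝ)
    (X : ℝ → EuclideanSpace ℝ (Fin d) → EuclideanSpace ℝ (Fin d)) : Prop :=
  ∃ Xe : ℝ → ℝ → EuclideanSpace ℝ (Fin d) → EuclideanSpace ℝ (Fin d),
    (∀ ε, 0 < ε → IsViscousFlow φ ε (Xe ε)) ∧
    ∀ t, 0 ≤ t → ∀ y, Tendsto (fun ε => Xe ε t y) (𝓝[>] 0) (𝓝 (X t y))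

/-! ### Measures -/

/-- The mass measure `ρ_t = (X_t)_♯ 𝓛`. -/
def massMeasure {d : ℕ} (X : ℝ → EuclideanSpace ℝ (Fin d) → EuclideanSpace ℝ (Fin d)) (t : ℝ) :
    Measure (EuclideanSpace ℝ (Fin d)) :=
  Measure.map (X t) volume

/-- The absolutely continuous part of `μ` with respect to Lebesgue measure, for `μ` having a
Lebesgue decomposition. -/
def acPart {d : ℕ} (μ : Measure (EuclideanSpace ℝ (Fin d))) :
    Measure (EuclideanSpace ℝ (Fin d)) :=
  volume.withDensity (μ.rnDeriv volume)

end Adhesion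

end

/-!
The supremum defining `w_t(x)` is attained at the feet of `x`, and `y ∈ ∂w_t(x)` if and only if
`T_t y = x`. Since `φ` is `λ`-concave, `w_t` is `1/(1 + tλ)`-strongly convex, so `ψ_t^{**}` has a
`(1 + tλ)`-Lipschitz gradient, and `(T_t)_♯ 𝓛` is the Monge–Ampère measure of `w_t`.

By the Gibbs variational inequality, `u^ε_t(x') - u^ε_t(x)` is at most the average of
`φ(x' - z) - φ(x - z)` under the Gibbs measure of the Cole–Hopf integral at `x`. Hence the viscous
potentials are `K`-Lipschitz and `λ`-concave in space uniformly in `ε`, and they converge to the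
Hopf–Lax solution. Two supergradient trajectories of `λ`-concave potentials separate by at most a
factor `exp(λt)`, so the viscous flows converge to a flow `X_t`; a foot at time `t` is joined to
its image by a straight trajectory, along which `X_s` and `T_s` agree.

Running the viscous flow backwards maps a small ball around `x` continuously onto a set close to
the fibre of `X_t` over `x`, hence each coordinate maps this fibre onto an interval. Were a fibre
to contain two points, it would meet a hyperplane `y_i = c` with `c` rational, and the countably
many images of these hyperplanes are null. So almost every fibre of `X_t` is a single point, the
foot, which is also the fibre of `T_t`; hence `ρ_t` and `(T_t)_♯ 𝓛` agree off a null set. The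
density is given by the change of variables formula for the Lipschitz map `T_t`, and conjugating
the second order expansion of `ψ_t^{**}` at `y` identifies `(DT_t(y))⁻¹` with the Alexandrov
Hessian of `w_t` at `T_t y`.
-/

namespace Adhesion

variable {d : ℕ}

/-! ### Strong convexity and semiconcavity -/

section StrongConvexity

variable {E : Type*} [NormedAddCommGroup E] [InnerProductSpace ℝ E] {f e : E → ℝ} {m c : ℝ}
  {x y p : E}

lemma isLambdaConcave_iff_strongConcaveOn {φ : EuclideanSpace ℝ (Fin d) → ℝ} {lam : ℝ} :
    IsLambdaConcave lam φ ↔ StrongConcaveOn univ (-lam) φ := by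
  simp only [strongConcaveOn_iff_convex, IsLambdaConcave, neg_div, neg_mul, sub_eq_add_neg]

lemma strongConvexOn_univ_iff :
    StrongConvexOn univ m f ↔ ∀ x y, ∀ a b : ℝ, 0 ≤ a → 0 ≤ b → a + b = 1 →
      f (a • x + b • y) + a * b * (m / 2 * ‖x - y‖ ^ 2) ≤ a * f x + b * f y := by
  simp only [StrongConvexOn, UniformConvexOn, convex_univ, true_and, mem_univ, forall_const,
    smul_eq_mul, le_sub_iff_add_le]

lemma strongConcaveOn_univ_neg_iff :
    StrongConcaveOn univ (-c) f ↔ ∀ x y, ∀ a b : ℝ, 0 ≤ a → 0 ≤ b → a + b = 1 →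
      a * f x + b * f y ≤ f (a • x + b • y) + a * b * (c / 2 * ‖x - y‖ ^ 2) := by
  simp only [StrongConcaveOn, UniformConcaveOn, convex_univ, true_and, mem_univ, forall_const,
    smul_eq_mul, neg_div, neg_mul, mul_neg, ← sub_eq_add_neg, sub_le_iff_le_add]

lemma add_inner_add_sq_le_of_strongConvexOn (hf : StrongConvexOn univ m f)
    (he : e =o[𝓝 0] fun h => h) (hp : ∀ h, f x + ⟪p, h⟫ + e h ≤ f (x + h)) (z : E) :
    f x + ⟪p, z - x⟫ + m / 2 * ‖z - x‖ ^ 2 ≤ f z := by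
  have hsegment : ∀ a ∈ Ioc (0 : ℝ) 1,
      f x + ⟪p, z - x⟫ + e (a • (z - x)) / a + (1 - a) * (m / 2 * ‖z - x‖ ^ 2) ≤ f z := by
    rintro a ⟨ha, ha1⟩
    have hconv := strongConvexOn_univ_iff.1 hf z x a (1 - a) ha.le (by linarith) (by ring)
    have hlin := hp (a • (z - x))
    rw [inner_smul_right] at hlin
    rw [show a • z + (1 - a) • x = x + a • (z - x) by module] at hconv
    refine le_of_mul_le_mul_left ?_ ha
    rw [mul_add, mul_add, mul_div_cancel₀ _ ha.ne']
    linarith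
  have herror : Tendsto (fun a : ℝ => e (a • (z - x)) / a) (𝓝[>] 0) (𝓝 0) := by
    have hsmul : Tendsto (fun a : ℝ => a • (z - x)) (𝓝[>] 0) (𝓝 0) :=
      ((continuous_id.smul continuous_const).tendsto' 0 0 (zero_smul ℝ _)).mono_left
        nhdsWithin_le_nhds
    suffices hbigO : (fun a : ℝ => a • (z - x)) =O[𝓝[>] 0] fun a => a from
      ((he.comp_tendsto hsmul).trans_isBigO hbigO).tendsto_div_nhds_zero
    refine Asymptotics.IsBigO.of_bound ‖z - x‖ (Eventually.of_forall fun a => ?_)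
    rw [norm_smul, mul_comm]
  have hlim : Tendsto (fun a : ℝ => f x + ⟪p, z - x⟫ + e (a • (z - x)) / a
      + (1 - a) * (m / 2 * ‖z - x‖ ^ 2)) (𝓝[>] 0)
      (𝓝 (f x + ⟪p, z - x⟫ + 0 + (1 - 0) * (m / 2 * ‖z - x‖ ^ 2))) :=
    (tendsto_const_nhds.add herror).add
      ((Continuous.tendsto (by fun_prop) 0).mono_left nhdsWithin_le_nhds)
  have hle := le_of_tendsto hlim (eventually_of_mem (Ioc_mem_nhdsGT one_pos) hsegment)
  rwa [add_zero, sub_zero, one_mul] at hle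

lemma le_add_inner_add_sq_of_strongConcaveOn (hf : StrongConcaveOn univ (-c) f)
    (he : e =o[𝓝 0] fun h => h) (hp : ∀ h, f (x + h) ≤ f x + ⟪p, h⟫ + e h) (z : E) :
    f z ≤ f x + ⟪p, z - x⟫ + c / 2 * ‖z - x‖ ^ 2 := by
  have := add_inner_add_sq_le_of_strongConvexOn (e := -e) (x := x) (p := -p)
    (UniformConcaveOn.neg hf) he.neg_left
    (fun h => by simp only [Pi.neg_apply, inner_neg_left]; linarith [hp h]) z
  simp only [Pi.neg_apply, inner_neg_left, neg_div, neg_mul] at this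
  linarith

-- The lower bound is used at the reflection `2y - z`, semiconcavity at the midpoint `y`.
lemma le_add_inner_add_sq_of_affine_le (hf : StrongConcaveOn univ (-c) f)
    (h : ∀ z, f y + ⟪p, z - y⟫ ≤ f z) (z : E) :
    f z ≤ f y + ⟪p, z - y⟫ + c * ‖z - y‖ ^ 2 := by
  have hmid := strongConcaveOn_univ_neg_iff.1 hf z ((2 : ℝ) • y - z) (1 / 2) (1 / 2)
    (by norm_num) (by norm_num) (by norm_num)
  have hreflect := h ((2 : ℝ) • y - z)
  rw [show (1 / 2 : ℝ) • z + (1 / 2 : ℝ) • ((2 : ℝ) • y - z) = y by module,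
    show z - ((2 : ℝ) • y - z) = (2 : ℝ) • (z - y) by module, norm_smul, Real.norm_ofNat] at hmid
  rw [show (2 : ℝ) • y - z - y = -(z - y) by module, inner_neg_right] at hreflect
  linarith

lemma hasGradientAt_of_abs_sub_inner_le [CompleteSpace E]
    (h : ∀ᶠ z in 𝓝 y, |f z - f y - ⟪p, z - y⟫| ≤ c * ‖z - y‖ ^ 2) :
    HasGradientAt f p y := by
  rw [hasGradientAt_iff_isLittleO]
  refine (Asymptotics.IsBigO.of_bound c (h.mono fun z hz => ?_)).trans_isLittleO
    (Asymptotics.isLittleO_pow_sub_sub y one_lt_two)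
  simpa only [Real.norm_eq_abs, abs_pow, abs_norm] using hz

end StrongConvexity

/-! ### Subgradients and the Legendre transform -/

section Legendre

variable {f g : EuclideanSpace ℝ (Fin d) → ℝ} {x y z : EuclideanSpace ℝ (Fin d)} {c m : ℝ}

lemma eq_gradient_of_mem_subgradient (hf : DifferentiableAt ℝ f x) (hy : y ∈ subgradient f x) :
    y = ∇ f x := by
  have hmin : IsLocalMin (fun z => f z - ⟪y, z⟫) x := Eventually.of_forall fun z => by
    have := hy z
    rw [inner_sub_right] at this
    linarith
  have hderiv := hmin.hasFDerivAt_eq_zero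
    (hf.hasGradientAt.hasFDerivAt.sub (innerSL ℝ y).hasFDerivAt)
  refine (InnerProductSpace.toDual ℝ _).injective (ContinuousLinearMap.ext fun z => ?_)
  exact (sub_eq_zero.1 (DFunLike.congr_fun hderiv z)).symm

lemma add_inner_add_sq_le_of_mem_subgradient (hf : StrongConvexOn univ m f)
    (hy : y ∈ subgradient f x) (z : EuclideanSpace ℝ (Fin d)) :
    f x + ⟪y, z - x⟫ + m / 2 * ‖z - x‖ ^ 2 ≤ f z :=
  add_inner_add_sq_le_of_strongConvexOn hf (Asymptotics.isLittleO_zero _ _)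
    (fun h => by simpa only [add_sub_cancel_left, add_zero] using hy (x + h)) z

/-- The supremum that defines the Legendre transform of `f` is attained at every point. This also
excludes the junk value of `⨆` on unbounded families. -/
def LegendreAttained (f : EuclideanSpace ℝ (Fin d) → ℝ) : Prop :=
  ∀ x, ∃ y, ∀ z, ⟪x, z⟫ - f z ≤ ⟪x, y⟫ - f y

lemma legendre_eq_of_forall_le (h : ∀ z, ⟪x, z⟫ - f z ≤ ⟪x, y⟫ - f y) :
    legendre f x = ⟪x, y⟫ - f y :=
  le_antisymm (ciSup_le h)
    (le_ciSup (f := fun z => ⟪x, z⟫ - f z) ⟨_, forall_mem_range.2 h⟩ y)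

lemma LegendreAttained.exists_eq (hf : LegendreAttained f) (x : EuclideanSpace ℝ (Fin d)) :
    ∃ y, legendre f x = ⟪x, y⟫ - f y :=
  (hf x).imp fun _ => legendre_eq_of_forall_le

lemma LegendreAttained.inner_sub_le (hf : LegendreAttained f) (x y : EuclideanSpace ℝ (Fin d)) :
    ⟪x, y⟫ - f y ≤ legendre f x := by
  obtain ⟨z, hz⟩ := hf x
  exact legendre_eq_of_forall_le hz ▸ hz y

lemma LegendreAttained.mem_subgradient_legendre (hf : LegendreAttained f)
    (h : legendre f x = ⟪x, y⟫ - f y) : y ∈ subgradient (legendre f) x := by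
  intro z
  have := hf.inner_sub_le z y
  rw [h, inner_sub_right, real_inner_comm z y, real_inner_comm x y]
  linarith

lemma LegendreAttained.mem_subgradient_iff (hf : LegendreAttained f) :
    y ∈ subgradient f x ↔ legendre f y = ⟪y, x⟫ - f x := by
  refine ⟨fun h => legendre_eq_of_forall_le fun z => ?_, fun h z => ?_⟩
  · have := h z
    rw [inner_sub_right] at this
    linarith
  · have := hf.inner_sub_le y z
    rw [inner_sub_right]
    linarith

lemma LegendreAttained.exists_mem_subgradient (hf : LegendreAttained f)
    (y : EuclideanSpace ℝ (Fin d)) : ∃ x, y ∈ subgradient f x :=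
  (hf.exists_eq y).imp fun _ => hf.mem_subgradient_iff.2

lemma LegendreAttained.legendre_eq_gradient (hf : LegendreAttained f)
    (hx : DifferentiableAt ℝ (legendre f) x) :
    legendre f x = ⟪x, ∇ (legendre f) x⟫ - f (∇ (legendre f) x) := by
  obtain ⟨y, hy⟩ := hf.exists_eq x
  rwa [← eq_gradient_of_mem_subgradient hx (hf.mem_subgradient_legendre hy)]

lemma LegendreAttained.gradient_legendre_mem_subgradient (hf : LegendreAttained f)
    (hx : DifferentiableAt ℝ (legendre f) x) :
    ∇ (legendre f) x ∈ subgradient (legendre f) x :=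
  hf.mem_subgradient_legendre (hf.legendre_eq_gradient hx)

-- The competitors are `y + (b / c) v` at `x₀` and `y - (a / c) v` at `x₁`, where `v = x₀ - x₁` and
-- `y` is optimal at `a x₀ + b x₁`: their average is `y`.
lemma LegendreAttained.strongConvexOn_legendre (hf : LegendreAttained f) (hc : 0 < c)
    (hconc : StrongConcaveOn univ (-c) f) : StrongConvexOn univ (1 / c) (legendre f) := by
  refine strongConvexOn_univ_iff.2 fun x₀ x₁ a b ha hb hab => ?_
  obtain ⟨y, hy⟩ := hf.exists_eq (a • x₀ + b • x₁)
  set v := x₀ - x₁ with hv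
  have h₀ := hf.inner_sub_le x₀ (y + (b / c) • v)
  have h₁ := hf.inner_sub_le x₁ (y - (a / c) • v)
  have hmid := strongConcaveOn_univ_neg_iff.1 hconc (y + (b / c) • v) (y - (a / c) • v) a b
    ha hb hab
  have haverage : a • (y + (b / c) • v) + b • (y - (a / c) • v) = y := by
    rw [show a • (y + (b / c) • v) + b • (y - (a / c) • v) = (a + b) • y by module, hab, one_smul]
  have hdifference : y + (b / c) • v - (y - (a / c) • v) = (1 / c) • v := by
    rw [← hab]; module
  have hinner : ⟪x₀, v⟫ - ⟪x₁, v⟫ = ‖v‖ ^ 2 := by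
    rw [← inner_sub_left, ← hv, real_inner_self_eq_norm_sq]
  rw [haverage, hdifference, norm_smul, Real.norm_of_nonneg (by positivity)] at hmid
  rw [inner_add_right, inner_smul_right] at h₀
  rw [inner_sub_right, inner_smul_right] at h₁
  rw [hy, inner_add_left, real_inner_smul_left, real_inner_smul_left]
  have hsum := add_le_add (mul_le_mul_of_nonneg_left h₀ ha) (mul_le_mul_of_nonneg_left h₁ hb)
  have hmodulus : c / 2 * (1 / c * ‖v‖) ^ 2 = 1 / c / 2 * ‖v‖ ^ 2 := by field_simp
  have hlinear : a * (b / c * ⟪x₀, v⟫) - b * (a / c * ⟪x₁, v⟫) =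
      2 * (a * b * (1 / c / 2 * ‖v‖ ^ 2)) := by
    rw [← hinner]; field_simp
  rw [hmodulus] at hmid
  linarith

lemma LegendreAttained.strictlyConvexAt_legendre (hg : LegendreAttained g)
    (hx : DifferentiableAt ℝ g x) (hy : y ∈ subgradient g x) :
    StrictlyConvexAt (legendre g) y := by
  have hy' := hg.mem_subgradient_iff.1 hy
  refine ⟨x, hg.mem_subgradient_legendre hy', fun z hz => ?_⟩
  have hle := hg.inner_sub_le z x
  rw [hy', real_inner_comm z x, real_inner_comm y x]
  refine lt_of_le_of_ne (by linarith) fun h => hz ?_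
  rw [eq_gradient_of_mem_subgradient hx hy]
  exact eq_gradient_of_mem_subgradient hx (hg.mem_subgradient_iff.2 (by linarith))

end Legendre

section LegendreOfStrongConvex

variable {g : EuclideanSpace ℝ (Fin d) → ℝ} {x y : EuclideanSpace ℝ (Fin d)} {m : ℝ}

lemma LegendreAttained.legendre_le_add_inner_add_sq (hg : LegendreAttained g) (hm : 0 < m)
    (hconv : StrongConvexOn univ m g) (hy : y ∈ subgradient g x) (z : EuclideanSpace ℝ (Fin d)) :
    legendre g z ≤ legendre g y + ⟪x, z - y⟫ + 1 / (2 * m) * ‖z - y‖ ^ 2 := by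
  obtain ⟨x', hx'⟩ := hg.exists_eq z
  rw [hx', hg.mem_subgradient_iff.1 hy]
  have hsub := add_inner_add_sq_le_of_mem_subgradient hconv hy x'
  have hyoung : ⟪x' - x, z - y⟫ ≤ m / 2 * ‖x' - x‖ ^ 2 + 1 / (2 * m) * ‖z - y‖ ^ 2 := by
    refine (real_inner_le_norm _ _).trans ?_
    have hsq : 0 ≤ (m * ‖x' - x‖ - ‖z - y‖) ^ 2 / (2 * m) := by positivity
    have : (m * ‖x' - x‖ - ‖z - y‖) ^ 2 / (2 * m) = m / 2 * ‖x' - x‖ ^ 2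
        + 1 / (2 * m) * ‖z - y‖ ^ 2 - ‖x' - x‖ * ‖z - y‖ := by field_simp; ring
    linarith
  simp only [inner_sub_left, inner_sub_right, real_inner_comm] at hsub hyoung ⊢
  linarith

lemma LegendreAttained.hasGradientAt_legendre (hg : LegendreAttained g) (hm : 0 < m)
    (hconv : StrongConvexOn univ m g) (hy : y ∈ subgradient g x) :
    HasGradientAt (legendre g) x y := by
  refine hasGradientAt_of_abs_sub_inner_le (c := 1 / (2 * m)) (Eventually.of_forall fun z => ?_)
  have hlower := hg.mem_subgradient_legendre (hg.mem_subgradient_iff.1 hy) z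
  have hupper := hg.legendre_le_add_inner_add_sq hm hconv hy z
  rw [abs_of_nonneg] <;> linarith

lemma LegendreAttained.gradient_legendre_eq_iff (hg : LegendreAttained g) (hm : 0 < m)
    (hconv : StrongConvexOn univ m g) : ∇ (legendre g) y = x ↔ y ∈ subgradient g x := by
  refine ⟨?_, fun h => (hg.hasGradientAt_legendre hm hconv h).gradient⟩
  rintro rfl
  obtain ⟨x, hx⟩ := hg.exists_mem_subgradient y
  rwa [(hg.hasGradientAt_legendre hm hconv hx).gradient]

lemma LegendreAttained.mul_norm_gradient_sub_sq_le_inner (hg : LegendreAttained g) (hm : 0 < m)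
    (hconv : StrongConvexOn univ m g) (y z : EuclideanSpace ℝ (Fin d)) :
    m * ‖∇ (legendre g) y - ∇ (legendre g) z‖ ^ 2 ≤
      ⟪y - z, ∇ (legendre g) y - ∇ (legendre g) z⟫ := by
  have hmem : ∀ y, y ∈ subgradient g (∇ (legendre g) y) := fun y =>
    (hg.gradient_legendre_eq_iff hm hconv).1 rfl
  have hy := add_inner_add_sq_le_of_mem_subgradient hconv (hmem y) (∇ (legendre g) z)
  have hz := add_inner_add_sq_le_of_mem_subgradient hconv (hmem z) (∇ (legendre g) y)
  rw [norm_sub_rev, ← neg_sub, inner_neg_right] at hy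
  rw [inner_sub_left]
  linarith

lemma LegendreAttained.norm_gradient_sub_le (hg : LegendreAttained g) (hm : 0 < m)
    (hconv : StrongConvexOn univ m g) (y z : EuclideanSpace ℝ (Fin d)) :
    ‖∇ (legendre g) y - ∇ (legendre g) z‖ ≤ 1 / m * ‖y - z‖ := by
  have hinner := (hg.mul_norm_gradient_sub_sq_le_inner hm hconv y z).trans (real_inner_le_norm _ _)
  rcases (norm_nonneg (∇ (legendre g) y - ∇ (legendre g) z)).eq_or_lt with h | h
  · rw [← h]; positivity
  · rw [one_div_mul_eq_div, le_div_iff₀' hm]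
    exact le_of_mul_le_mul_right (by linarith) h

end LegendreOfStrongConvex

/-! ### The potentials `ψ_t`, `w_t` and the Hopf–Lax solution -/

lemma le_add_mul_norm_sub_of_lipschitzWith {E : Type*} [SeminormedAddCommGroup E] {f : E → ℝ}
    {K : ℝ≥0} (hf : LipschitzWith K f) (x y : E) : f x ≤ f y + K * ‖x - y‖ :=
  dist_eq_norm x y ▸ hf.le_add_mul x y

section Potentials

variable {φ : EuclideanSpace ℝ (Fin d) → ℝ} {K : ℝ≥0} {lam t : ℝ}
  {x y z : EuclideanSpace ℝ (Fin d)}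

lemma strongConcaveOn_psi (ht : 0 ≤ t) (hconc : IsLambdaConcave lam φ) :
    StrongConcaveOn univ (-(1 + t * lam)) (psi φ t) := by
  have h : ConcaveOn ℝ univ (t • fun y => φ y - lam / 2 * ‖y‖ ^ 2) := ConcaveOn.smul ht hconc
  refine isLambdaConcave_iff_strongConcaveOn.1 (h.congr fun y _ => ?_)
  simp only [psi, Pi.smul_apply, smul_eq_mul]
  ring

lemma legendreAttained_psi (ht : 0 ≤ t) (hK : LipschitzWith K φ) :
    LegendreAttained (psi φ t) := by
  intro x
  have hcont : Continuous fun z => ⟪x, z⟫ - psi φ t z := by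
    have := hK.continuous
    unfold psi
    fun_prop
  refine hcont.exists_forall_ge' 0 ?_
  filter_upwards [(tendsto_norm_cocompact_atTop
    (E := EuclideanSpace ℝ (Fin d))).eventually_ge_atTop (2 * (‖x‖ + t * K))] with z hz
  have hφ := mul_le_mul_of_nonneg_left (le_add_mul_norm_sub_of_lipschitzWith hK 0 z) ht
  have hinner := real_inner_le_norm x z
  have hsq := mul_le_mul_of_nonneg_left hz (norm_nonneg z)
  rw [zero_sub, norm_neg] at hφ
  simp only [psi, inner_zero_right, norm_zero]
  linarith

lemma inner_sub_psi_le_w (ht : 0 ≤ t) (hK : LipschitzWith K φ)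
    (x y : EuclideanSpace ℝ (Fin d)) : ⟪x, y⟫ - psi φ t y ≤ w φ t x :=
  (legendreAttained_psi ht hK).inner_sub_le x y

/-- `y` is a foot of `x` at time `t`: it attains the supremum defining `w_t(x)`, equivalently the
infimum in the Hopf–Lax formula at `x`. -/
def IsFoot (φ : EuclideanSpace ℝ (Fin d) → ℝ) (t : ℝ) (x y : EuclideanSpace ℝ (Fin d)) : Prop :=
  w φ t x = ⟪x, y⟫ - psi φ t y

lemma exists_isFoot (ht : 0 ≤ t) (hK : LipschitzWith K φ) (x : EuclideanSpace ℝ (Fin d)) :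
    ∃ y, IsFoot φ t x y :=
  (legendreAttained_psi ht hK).exists_eq x

lemma IsFoot.mem_subgradient (h : IsFoot φ t x y) (ht : 0 ≤ t) (hK : LipschitzWith K φ) :
    y ∈ subgradient (w φ t) x :=
  (legendreAttained_psi ht hK).mem_subgradient_legendre h

/-- The Hopf–Lax solution `u_t(x) = inf_y (|x - y|²/(2t) + φ y)` of `∂_t u + |∇u|²/2 = 0`. -/
noncomputable def hopfLax (φ : EuclideanSpace ℝ (Fin d) → ℝ) (t : ℝ)
    (x : EuclideanSpace ℝ (Fin d)) : ℝ :=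
  ⨅ y, (‖x - y‖ ^ 2 / (2 * t) + φ y)

lemma sq_norm_sub_div_add_eq (ht : t ≠ 0) (x y : EuclideanSpace ℝ (Fin d)) :
    ‖x - y‖ ^ 2 / (2 * t) + φ y = (1 / 2 * ‖x‖ ^ 2 - (⟪x, y⟫ - psi φ t y)) / t := by
  rw [norm_sub_sq_real, psi]
  field_simp
  ring

lemma hopfLax_eq (ht : 0 < t) (hK : LipschitzWith K φ) (x : EuclideanSpace ℝ (Fin d)) :
    hopfLax φ t x = (1 / 2 * ‖x‖ ^ 2 - w φ t x) / t := by
  have hle : ∀ y, (1 / 2 * ‖x‖ ^ 2 - w φ t x) / t ≤ ‖x - y‖ ^ 2 / (2 * t) + φ y := fun y => by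
    rw [sq_norm_sub_div_add_eq ht.ne']
    gcongr
    exact inner_sub_psi_le_w ht.le hK x y
  obtain ⟨y, hy⟩ := exists_isFoot ht.le hK x
  refine le_antisymm ((ciInf_le ⟨_, forall_mem_range.2 hle⟩ y).trans_eq ?_) (le_ciInf hle)
  rw [sq_norm_sub_div_add_eq ht.ne', ← hy]

lemma hopfLax_le (ht : 0 < t) (hK : LipschitzWith K φ) (x y : EuclideanSpace ℝ (Fin d)) :
    hopfLax φ t x ≤ ‖x - y‖ ^ 2 / (2 * t) + φ y := by
  rw [hopfLax_eq ht hK, sq_norm_sub_div_add_eq ht.ne']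
  gcongr
  exact inner_sub_psi_le_w ht.le hK x y

lemma isFoot_iff_hopfLax_eq (ht : 0 < t) (hK : LipschitzWith K φ) :
    IsFoot φ t x y ↔ hopfLax φ t x = ‖x - y‖ ^ 2 / (2 * t) + φ y := by
  rw [hopfLax_eq ht hK, sq_norm_sub_div_add_eq ht.ne', div_left_inj' ht.ne', sub_right_inj, IsFoot]

lemma exists_hopfLax_eq (ht : 0 < t) (hK : LipschitzWith K φ) (x : EuclideanSpace ℝ (Fin d)) :
    ∃ y, hopfLax φ t x = ‖x - y‖ ^ 2 / (2 * t) + φ y :=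
  (exists_isFoot ht.le hK x).imp fun _ => (isFoot_iff_hopfLax_eq ht hK).1

lemma lipschitzWith_hopfLax (ht : 0 < t) (hK : LipschitzWith K φ) :
    LipschitzWith K (hopfLax φ t) := by
  refine LipschitzWith.of_le_add_mul K fun x x' => ?_
  obtain ⟨y, hy⟩ := exists_hopfLax_eq ht hK x'
  have hle := hopfLax_le ht hK x (y + (x - x'))
  have hφ := le_add_mul_norm_sub_of_lipschitzWith hK (y + (x - x')) y
  rw [show x - (y + (x - x')) = x' - y by abel] at hle
  rw [add_sub_cancel_left] at hφ
  rw [dist_eq_norm]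
  linarith

-- The competitor at each endpoint is the endpoint minus the optimal displacement `v` at the
-- intermediate point, so the quadratic terms agree.
lemma strongConcaveOn_hopfLax (ht : 0 < t) (hK : LipschitzWith K φ)
    (hconc : IsLambdaConcave lam φ) : StrongConcaveOn univ (-lam) (hopfLax φ t) := by
  rw [isLambdaConcave_iff_strongConcaveOn, strongConcaveOn_univ_neg_iff] at hconc
  refine strongConcaveOn_univ_neg_iff.2 fun x₀ x₁ a b ha hb hab => ?_
  obtain ⟨y, hy⟩ := exists_hopfLax_eq ht hK (a • x₀ + b • x₁)
  set v := a • x₀ + b • x₁ - y with hv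
  have h₀ := hopfLax_le ht hK x₀ (x₀ - v)
  have h₁ := hopfLax_le ht hK x₁ (x₁ - v)
  have hφ := hconc (x₀ - v) (x₁ - v) a b ha hb hab
  have haverage : a • (x₀ - v) + b • (x₁ - v) = y := by
    rw [show a • (x₀ - v) + b • (x₁ - v) = a • x₀ + b • x₁ - (a + b) • v by module, hab, one_smul,
      hv, sub_sub_cancel]
  rw [sub_sub_cancel] at h₀ h₁
  rw [haverage, sub_sub_sub_cancel_right] at hφ
  have hsum := add_le_add (mul_le_mul_of_nonneg_left h₀ ha) (mul_le_mul_of_nonneg_left h₁ hb)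
  have hweights : a * (‖v‖ ^ 2 / (2 * t)) + b * (‖v‖ ^ 2 / (2 * t)) = ‖v‖ ^ 2 / (2 * t) := by
    rw [← add_mul, hab, one_mul]
  linarith

lemma w_zero (φ : EuclideanSpace ℝ (Fin d) → ℝ) (x : EuclideanSpace ℝ (Fin d)) :
    w φ 0 x = 1 / 2 * ‖x‖ ^ 2 := by
  have hfoot : w φ 0 x = ⟪x, x⟫ - psi φ 0 x := legendre_eq_of_forall_le fun z => by
    have := norm_sub_sq_real x z
    rw [psi, psi, real_inner_self_eq_norm_sq]
    linarith [sq_nonneg ‖x - z‖]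
  rw [hfoot, real_inner_self_eq_norm_sq, psi]
  ring

lemma w_eq_psi_neg_hopfLax (ht : 0 < t) (hK : LipschitzWith K φ) :
    w φ t = psi (fun x => -hopfLax φ t x) t := by
  ext x
  rw [psi, hopfLax_eq ht hK]
  field_simp
  ring

lemma exists_lipschitzWith_w_eq_psi (ht : 0 ≤ t) (hK : LipschitzWith K φ) :
    ∃ g : EuclideanSpace ℝ (Fin d) → ℝ, LipschitzWith K g ∧ w φ t = psi g t := by
  rcases ht.eq_or_lt with rfl | ht
  · refine ⟨φ, hK, funext fun x => ?_⟩
    rw [w_zero, psi, zero_mul, add_zero]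
  · exact ⟨_, (lipschitzWith_hopfLax ht hK).neg, w_eq_psi_neg_hopfLax ht hK⟩

lemma legendreAttained_w (ht : 0 ≤ t) (hK : LipschitzWith K φ) : LegendreAttained (w φ t) := by
  obtain ⟨g, hg, hw⟩ := exists_lipschitzWith_w_eq_psi ht hK
  exact hw ▸ legendreAttained_psi ht hg

lemma strongConvexOn_w (ht : 0 ≤ t) (hK : LipschitzWith K φ) (hlam : 0 ≤ lam)
    (hconc : IsLambdaConcave lam φ) : StrongConvexOn univ (1 / (1 + t * lam)) (w φ t) :=
  (legendreAttained_psi ht hK).strongConvexOn_legendre (by positivity)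
    (strongConcaveOn_psi ht hconc)

lemma ae_differentiableAt_w (ht : 0 < t) (hK : LipschitzWith K φ) :
    ∀ᵐ x : EuclideanSpace ℝ (Fin d), DifferentiableAt ℝ (w φ t) x := by
  filter_upwards [(lipschitzWith_hopfLax ht hK).ae_differentiableAt] with x hx
  rw [w_eq_psi_neg_hopfLax ht hK]
  exact ((differentiableAt_id.norm_sq ℝ).const_mul _).add (hx.neg.const_mul _)

lemma gradient_w_mem_Sigma (ht : 0 ≤ t) (hK : LipschitzWith K φ)
    (hx : DifferentiableAt ℝ (w φ t) x) : ∇ (w φ t) x ∈ Sigma φ t :=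
  (legendreAttained_w ht hK).strictlyConvexAt_legendre hx
    ((legendreAttained_psi ht hK).gradient_legendre_mem_subgradient hx)

/-! ### The convexified transport map -/

lemma T_eq_iff (ht : 0 ≤ t) (hK : LipschitzWith K φ) (hlam : 0 ≤ lam)
    (hconc : IsLambdaConcave lam φ) : T φ t y = x ↔ y ∈ subgradient (w φ t) x :=
  (legendreAttained_w ht hK).gradient_legendre_eq_iff (by positivity)
    (strongConvexOn_w ht hK hlam hconc)

lemma mem_subgradient_T (ht : 0 ≤ t) (hK : LipschitzWith K φ) (hlam : 0 ≤ lam)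
    (hconc : IsLambdaConcave lam φ) (y : EuclideanSpace ℝ (Fin d)) :
    y ∈ subgradient (w φ t) (T φ t y) :=
  (T_eq_iff ht hK hlam hconc).1 rfl

lemma hasGradientAt_psiConv (ht : 0 ≤ t) (hK : LipschitzWith K φ) (hlam : 0 ≤ lam)
    (hconc : IsLambdaConcave lam φ) (y : EuclideanSpace ℝ (Fin d)) :
    HasGradientAt (psiConv φ t) (T φ t y) y :=
  (legendreAttained_w ht hK).hasGradientAt_legendre (by positivity)
    (strongConvexOn_w ht hK hlam hconc) (mem_subgradient_T ht hK hlam hconc y)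

lemma norm_T_sub_sq_le_inner (ht : 0 ≤ t) (hK : LipschitzWith K φ) (hlam : 0 ≤ lam)
    (hconc : IsLambdaConcave lam φ) (y z : EuclideanSpace ℝ (Fin d)) :
    1 / (1 + t * lam) * ‖T φ t y - T φ t z‖ ^ 2 ≤ ⟪y - z, T φ t y - T φ t z⟫ :=
  (legendreAttained_w ht hK).mul_norm_gradient_sub_sq_le_inner (by positivity)
    (strongConvexOn_w ht hK hlam hconc) y z

lemma lipschitzWith_T (ht : 0 ≤ t) (hK : LipschitzWith K φ) (hlam : 0 ≤ lam)
    (hconc : IsLambdaConcave lam φ) : LipschitzWith (1 + t * lam).toNNReal (T φ t) := by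
  refine LipschitzWith.of_dist_le_mul fun y z => ?_
  rw [dist_eq_norm, dist_eq_norm, Real.coe_toNNReal _ (by positivity),
    ← one_div_one_div (1 + t * lam)]
  exact (legendreAttained_w ht hK).norm_gradient_sub_le (by positivity)
    (strongConvexOn_w ht hK hlam hconc) y z

lemma norm_sub_le_of_mem_subgradient_psi (ht : 0 ≤ t) (hK : LipschitzWith K φ)
    (hy : y ∈ subgradient (psi φ t) x) : ‖x - y‖ ≤ 2 * t * K := by
  have hsub := hy y
  have hφ := mul_le_mul_of_nonneg_left (le_add_mul_norm_sub_of_lipschitzWith hK y x) ht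
  have hsq := norm_sub_sq_real x y
  rw [psi, psi, inner_sub_right, real_inner_self_eq_norm_sq, real_inner_comm] at hsub
  rw [norm_sub_rev] at hφ
  rcases (norm_nonneg (x - y)).eq_or_lt with h | h
  · rw [← h]; positivity
  · exact le_of_mul_le_mul_right (by linarith) h

lemma norm_T_sub_le (ht : 0 ≤ t) (hK : LipschitzWith K φ) (hlam : 0 ≤ lam)
    (hconc : IsLambdaConcave lam φ) (y : EuclideanSpace ℝ (Fin d)) :
    ‖T φ t y - y‖ ≤ 2 * t * K := by
  obtain ⟨g, hg, hw⟩ := exists_lipschitzWith_w_eq_psi ht hK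
  exact norm_sub_le_of_mem_subgradient_psi ht hg (hw ▸ mem_subgradient_T ht hK hlam hconc y)

lemma T_preimage_of_differentiableAt (ht : 0 ≤ t) (hK : LipschitzWith K φ) (hlam : 0 ≤ lam)
    (hconc : IsLambdaConcave lam φ) (hx : DifferentiableAt ℝ (w φ t) x) :
    T φ t ⁻¹' {x} = {∇ (w φ t) x} := by
  ext y
  rw [mem_preimage, mem_singleton_iff, mem_singleton_iff, T_eq_iff ht hK hlam hconc]
  refine ⟨eq_gradient_of_mem_subgradient hx, ?_⟩
  rintro rfl
  exact (legendreAttained_psi ht hK).gradient_legendre_mem_subgradient hx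

/-! ### Free streaming -/

lemma IsFoot.hasGradientAt (h : IsFoot φ t x y) (ht : 0 < t) (hK : LipschitzWith K φ)
    (hconc : IsLambdaConcave lam φ) : HasGradientAt φ (t⁻¹ • (x - y)) y := by
  have hlower : ∀ z, psi φ t y + ⟪x, z - y⟫ ≤ psi φ t z := fun z => by
    have := inner_sub_psi_le_w ht.le hK x z
    rw [h] at this
    rw [inner_sub_right]
    linarith
  have hupper := le_add_inner_add_sq_of_affine_le (strongConcaveOn_psi ht.le hconc) hlower
  refine hasGradientAt_of_abs_sub_inner_le (c := (1 + t * lam + 1 / 2) / t)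
    (Eventually.of_forall fun z => ?_)
  have hremainder : φ z - φ y - ⟪t⁻¹ • (x - y), z - y⟫
      = (psi φ t z - psi φ t y - ⟪x, z - y⟫ - 1 / 2 * ‖z - y‖ ^ 2) / t := by
    rw [real_inner_smul_left, psi, psi, norm_sub_sq_real, inner_sub_left, inner_sub_right y z y,
      real_inner_self_eq_norm_sq, real_inner_comm y z]
    field_simp
    ring
  rw [hremainder, abs_div, abs_of_pos ht, div_mul_eq_mul_div (_ + _)]
  refine div_le_div_of_nonneg_right (abs_le.2 ?_) ht.le
  have hlower_z := hlower z
  have hupper_z := hupper z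
  constructor <;> linarith [sq_nonneg ‖z - y‖]

-- The maximized function at time `s` is a convex combination of the one at time `t` and of
-- `⟪y, ·⟫ - ‖·‖²/2`, both of which are maximal at `y`.
lemma IsFoot.isFoot_of_le (h : IsFoot φ t x y) (ht : 0 < t) (hK : LipschitzWith K φ) {s : ℝ}
    (hs : 0 ≤ s) (hst : s ≤ t) : IsFoot φ s (y + s • t⁻¹ • (x - y)) y := by
  refine legendre_eq_of_forall_le fun z => ?_
  have hcombination : ∀ z, ⟪y + s • t⁻¹ • (x - y), z⟫ - psi φ s z
      = s / t * (⟪x, z⟫ - psi φ t z) + (1 - s / t) * (⟪y, z⟫ - 1 / 2 * ‖z‖ ^ 2) := by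
    intro z
    rw [inner_add_left, real_inner_smul_left, real_inner_smul_left, inner_sub_left, psi, psi]
    field_simp
    ring
  rw [hcombination z, hcombination y]
  have hx : ⟪x, z⟫ - psi φ t z ≤ ⟪x, y⟫ - psi φ t y := h ▸ inner_sub_psi_le_w ht.le hK x z
  have hy : ⟪y, z⟫ - 1 / 2 * ‖z‖ ^ 2 ≤ ⟪y, y⟫ - 1 / 2 * ‖y‖ ^ 2 := by
    rw [real_inner_self_eq_norm_sq]
    linarith [norm_sub_sq_real y z, sq_nonneg ‖y - z‖]
  have hst' : 0 ≤ 1 - s / t := sub_nonneg.2 ((div_le_one ht).2 hst)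
  gcongr

end Potentials

/-! ### Trajectories of semiconcave velocity fields -/

section Flow

variable {E : Type*} [NormedAddCommGroup E] [InnerProductSpace ℝ E]

lemma le_exp_mul_add_of_deriv_le {u u' : ℝ → ℝ} {k c a b : ℝ} (hab : a ≤ b)
    (hu : ContinuousOn u (Icc a b)) (hu' : ∀ s ∈ Ioo a b, HasDerivAt u (u' s) s)
    (hle : ∀ s ∈ Ioo a b, u' s ≤ k * u s + c) (hk : 0 ≤ k) (hc : 0 ≤ c) :
    u b ≤ Real.exp (k * (b - a)) * (u a + c * (b - a)) := by
  let F : ℝ → ℝ := fun s => Real.exp (-(k * (s - a))) * u s - c * (s - a)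
  have hF' : ∀ s ∈ Ioo a b, HasDerivAt F
      (Real.exp (-(k * (s - a))) * -k * u s + Real.exp (-(k * (s - a))) * u' s - c) s := by
    intro s hs
    have hlin (m : ℝ) : HasDerivAt (fun s => m * (s - a)) m s := by
      simpa using ((hasDerivAt_id s).sub_const a).const_mul m
    exact ((hlin k).fun_neg.exp.mul (hu' s hs)).sub (hlin c)
  have hF : ContinuousOn F (Icc a b) := by fun_prop
  have hanti : AntitoneOn F (Icc a b) := by
    refine antitoneOn_of_hasDerivWithinAt_nonpos (convex_Icc a b) hF
      (fun s hs => (hF' s (by rwa [interior_Icc] at hs)).hasDerivWithinAt) fun s hs => ?_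
    rw [interior_Icc] at hs
    have hexp : Real.exp (-(k * (s - a))) ≤ 1 :=
      Real.exp_le_one_iff.2 (neg_nonpos.2 (mul_nonneg hk (sub_nonneg.2 hs.1.le)))
    linarith [mul_le_mul_of_nonneg_left (hle s hs) (Real.exp_pos (-(k * (s - a)))).le,
      mul_le_mul_of_nonneg_right hexp hc]
  have hFab : F b ≤ F a := hanti (left_mem_Icc.2 hab) (right_mem_Icc.2 hab) hab
  simp only [F, sub_self, mul_zero, neg_zero, Real.exp_zero, one_mul, sub_zero] at hFab
  calc u b = Real.exp (k * (b - a)) * (Real.exp (-(k * (b - a))) * u b) := by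
        rw [← mul_assoc, ← Real.exp_add, add_neg_cancel, Real.exp_zero, one_mul]
    _ ≤ Real.exp (k * (b - a)) * (u a + c * (b - a)) := by
        gcongr
        linarith

lemma inner_sub_sub_le_of_supergradient {U₁ U₂ : E → ℝ} {x₁ x₂ p₁ p₂ : E} {lam η : ℝ}
    (h₁ : ∀ z, U₁ z ≤ U₁ x₁ + ⟪p₁, z - x₁⟫ + lam / 2 * ‖z - x₁‖ ^ 2)
    (h₂ : ∀ z, U₂ z ≤ U₂ x₂ + ⟪p₂, z - x₂⟫ + lam / 2 * ‖z - x₂‖ ^ 2)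
    (hη : ∀ z, |U₁ z - U₂ z| ≤ η) :
    ⟪x₁ - x₂, p₁ - p₂⟫ ≤ lam * ‖x₁ - x₂‖ ^ 2 + 2 * η := by
  have h₁₂ := h₁ x₂
  have h₂₁ := h₂ x₁
  rw [norm_sub_rev, ← neg_sub x₁ x₂, inner_neg_right] at h₁₂
  rw [real_inner_comm, inner_sub_left]
  linarith [(abs_le.1 (hη x₁)).2, (abs_le.1 (hη x₂)).1]

lemma norm_sub_sq_le_of_supergradient {γ₁ γ₂ p₁ p₂ : ℝ → E} {U₁ U₂ : ℝ → E → ℝ}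
    {lam η a b : ℝ} (hab : a ≤ b)
    (hc₁ : ContinuousOn γ₁ (Icc a b)) (hc₂ : ContinuousOn γ₂ (Icc a b))
    (hd₁ : ∀ s ∈ Ioo a b, HasDerivAt γ₁ (p₁ s) s) (hd₂ : ∀ s ∈ Ioo a b, HasDerivAt γ₂ (p₂ s) s)
    (hU₁ : ∀ s ∈ Ioo a b, ∀ z,
      U₁ s z ≤ U₁ s (γ₁ s) + ⟪p₁ s, z - γ₁ s⟫ + lam / 2 * ‖z - γ₁ s‖ ^ 2)
    (hU₂ : ∀ s ∈ Ioo a b, ∀ z,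
      U₂ s z ≤ U₂ s (γ₂ s) + ⟪p₂ s, z - γ₂ s⟫ + lam / 2 * ‖z - γ₂ s‖ ^ 2)
    (hη : ∀ s ∈ Ioo a b, ∀ z, |U₁ s z - U₂ s z| ≤ η) (hlam : 0 ≤ lam) (hη0 : 0 ≤ η) :
    ‖γ₁ b - γ₂ b‖ ^ 2 ≤
      Real.exp (2 * lam * (b - a)) * (‖γ₁ a - γ₂ a‖ ^ 2 + 4 * η * (b - a)) := by
  refine le_exp_mul_add_of_deriv_le (u := fun s => ‖γ₁ s - γ₂ s‖ ^ 2) hab (by fun_prop)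
    (fun s hs => ((hd₁ s hs).fun_sub (hd₂ s hs)).norm_sq) (fun s hs => ?_) (by positivity)
    (by positivity)
  linarith [inner_sub_sub_le_of_supergradient (hU₁ s hs) (hU₂ s hs) (hη s hs)]

/-- A bounded velocity field `v`, Lipschitz on bounded sets for times away from `0`, which consists
of supergradients of the semiconcave potentials `U t`. No regularity is asked for as `t → 0`, where
the velocity fields of the adhesion model become rough. -/
structure SemiconcaveField (K : ℝ≥0) (lam : ℝ) (U : ℝ → E → ℝ) (v : ℝ → E → E) : Prop where
  norm_le : ∀ t, 0 < t → ∀ x, ‖v t x‖ ≤ K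
  lipschitz : ∀ a b R : ℝ, 0 < a → ∃ L : ℝ≥0, ∀ t ∈ Icc a b,
    LipschitzOnWith L (v t) (Metric.closedBall 0 R)
  continuousOn : ∀ x, ContinuousOn (fun t => v t x) (Ioi 0)
  le : ∀ t, 0 < t → ∀ x z, U t z ≤ U t x + ⟪v t x, z - x⟫ + lam / 2 * ‖z - x‖ ^ 2
  lam_nonneg : 0 ≤ lam

/-- `γ` is a trajectory of `v` on `[0, ∞)` starting at `y`. The differential equation holds for
positive times only. -/
def IsTrajectory (v : ℝ → E → E) (y : E) (γ : ℝ → E) : Prop :=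
  γ 0 = y ∧ ContinuousWithinAt γ (Ici 0) 0 ∧ ∀ t, 0 < t → HasDerivAt γ (v t (γ t)) t

variable {K : ℝ≥0} {lam : ℝ} {U : ℝ → E → ℝ} {v : ℝ → E → E} {a b t : ℝ} {x y : E} {γ : ℝ → E}

lemma IsTrajectory.continuousOn (h : IsTrajectory v y γ) (b : ℝ) : ContinuousOn γ (Icc 0 b) := by
  intro s hs
  rcases hs.1.eq_or_lt with rfl | hs0
  · exact h.2.1.mono Icc_subset_Ici_self
  · exact (h.2.2 s hs0).continuousAt.continuousWithinAt

lemma IsTrajectory.isIntegralCurveOn (h : IsTrajectory v y γ) (ha : 0 < a) (b : ℝ) :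
    IsIntegralCurveOn γ v (Icc a b) := fun s hs =>
  (h.2.2 s (ha.trans_le hs.1)).hasDerivWithinAt

lemma isTrajectory_update {α : ℝ → E} {c : ℝ}
    (hα : ∀ t, 0 < t → HasDerivAt α (v t (α t)) t) (hle : ∀ t, 0 < t → ‖α t - y‖ ≤ c * t) :
    IsTrajectory v y (Function.update α 0 y) := by
  refine ⟨Function.update_self .., ?_, fun t ht => ?_⟩
  · have hzero : Tendsto (fun s : ℝ => c * s) (𝓝[>] 0) (𝓝 0) :=
      ((continuous_const_mul c).tendsto' 0 0 (mul_zero c)).mono_left nhdsWithin_le_nhds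
    rw [continuousWithinAt_update_same, Ici_sdiff_left, tendsto_iff_norm_sub_tendsto_zero]
    refine squeeze_zero' (Eventually.of_forall fun s => norm_nonneg _) ?_ hzero
    filter_upwards [self_mem_nhdsWithin] with s hs using hle s hs
  · rw [Function.update_of_ne ht.ne']
    refine (hα t ht).congr_of_eventuallyEq ?_
    filter_upwards [Ioi_mem_nhds ht] with s hs
    exact Function.update_of_ne (ne_of_gt hs) _ _

namespace SemiconcaveField

lemma norm_sub_le_of_isIntegralCurveOn (h : SemiconcaveField K lam U v) (ha : 0 < a)
    (hγ : IsIntegralCurveOn γ v (Icc a b)) {s t : ℝ} (hs : s ∈ Icc a b) (ht : t ∈ Icc a b) :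
    ‖γ t - γ s‖ ≤ K * |t - s| :=
  (convex_Icc a b).norm_image_sub_le_of_norm_hasDerivWithin_le hγ
    (fun r hr => h.norm_le r (ha.trans_le hr.1) _) hs ht

lemma norm_sub_left_le_of_isIntegralCurveOn (h : SemiconcaveField K lam U v) (ha : 0 < a)
    (hγ : IsIntegralCurveOn γ v (Icc a b)) (ht : t ∈ Icc a b) : ‖γ t - γ a‖ ≤ K * t := by
  have hle := h.norm_sub_le_of_isIntegralCurveOn ha hγ (left_mem_Icc.2 (ht.1.trans ht.2)) ht
  rw [abs_of_nonneg (sub_nonneg.2 ht.1)] at hle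
  refine hle.trans ?_
  gcongr
  linarith

lemma norm_sub_le_of_isTrajectory (h : SemiconcaveField K lam U v) (hγ : IsTrajectory v y γ)
    (ht : 0 ≤ t) : ‖γ t - y‖ ≤ K * t := by
  rcases ht.eq_or_lt with rfl | ht
  · simp [hγ.1]
  have hlim : Tendsto γ (𝓝[>] 0) (𝓝 y) :=
    hγ.1 ▸ hγ.2.1.tendsto.mono_left (nhdsWithin_mono _ Ioi_subset_Ici_self)
  refine le_of_tendsto (tendsto_const_nhds.sub hlim).norm ?_
  filter_upwards [Ioc_mem_nhdsGT ht] with s hs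
  exact h.norm_sub_left_le_of_isIntegralCurveOn hs.1 (hγ.isIntegralCurveOn hs.1 t)
    (right_mem_Icc.2 hs.2)

lemma norm_sub_le_exp_mul (h : SemiconcaveField K lam U v) {γ₁ γ₂ : ℝ → E} (ha : 0 ≤ a)
    (hab : a ≤ b) (hc₁ : ContinuousOn γ₁ (Icc a b)) (hc₂ : ContinuousOn γ₂ (Icc a b))
    (hd₁ : ∀ s ∈ Ioo a b, HasDerivAt γ₁ (v s (γ₁ s)) s)
    (hd₂ : ∀ s ∈ Ioo a b, HasDerivAt γ₂ (v s (γ₂ s)) s) :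
    ‖γ₁ b - γ₂ b‖ ≤ Real.exp (lam * b) * ‖γ₁ a - γ₂ a‖ := by
  have hsq := norm_sub_sq_le_of_supergradient (η := 0) hab hc₁ hc₂ hd₁ hd₂
    (fun s hs => h.le s (ha.trans_lt hs.1) _) (fun s hs => h.le s (ha.trans_lt hs.1) _)
    (fun s _ z => by simp) h.lam_nonneg le_rfl
  have hexp : Real.exp (2 * lam * (b - a)) ≤ Real.exp (lam * b) ^ 2 := by
    rw [← Real.exp_nat_mul]
    refine Real.exp_le_exp.2 ?_
    push_cast
    linarith [mul_nonneg h.lam_nonneg ha]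
  refine le_of_sq_le_sq ?_ (by positivity)
  rw [mul_pow]
  refine hsq.trans ?_
  simp only [mul_zero, zero_mul, add_zero]
  gcongr

lemma norm_sub_le_exp_mul_of_isIntegralCurveOn (h : SemiconcaveField K lam U v)
    {γ₁ γ₂ : ℝ → E} (ha : 0 ≤ a) (hab : a ≤ b) (h₁ : IsIntegralCurveOn γ₁ v (Icc a b))
    (h₂ : IsIntegralCurveOn γ₂ v (Icc a b)) :
    ‖γ₁ b - γ₂ b‖ ≤ Real.exp (lam * b) * ‖γ₁ a - γ₂ a‖ :=
  h.norm_sub_le_exp_mul ha hab (fun s hs => (h₁ s hs).continuousWithinAt)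
    (fun s hs => (h₂ s hs).continuousWithinAt)
    (fun s hs => (h₁ s (Ioo_subset_Icc_self hs)).hasDerivAt (Icc_mem_nhds hs.1 hs.2))
    (fun s hs => (h₂ s (Ioo_subset_Icc_self hs)).hasDerivAt (Icc_mem_nhds hs.1 hs.2))

lemma norm_sub_le_exp_mul_of_isTrajectory (h : SemiconcaveField K lam U v) {γ₁ γ₂ : ℝ → E}
    {y₁ y₂ : E} (h₁ : IsTrajectory v y₁ γ₁) (h₂ : IsTrajectory v y₂ γ₂) (ht : 0 ≤ t) :
    ‖γ₁ t - γ₂ t‖ ≤ Real.exp (lam * t) * ‖y₁ - y₂‖ := by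
  simpa only [h₁.1, h₂.1] using h.norm_sub_le_exp_mul le_rfl ht (h₁.continuousOn t)
    (h₂.continuousOn t) (fun s hs => h₁.2.2 s hs.1) (fun s hs => h₂.2.2 s hs.1)

lemma norm_sub_le_of_isTrajectory_of_isIntegralCurveOn
    (h : SemiconcaveField K lam U v) {β : ℝ → E} (ha : 0 < a) (hab : a ≤ b)
    (hγ : IsTrajectory v (β a) γ) (hβ : IsIntegralCurveOn β v (Icc a b)) :
    ‖γ b - β b‖ ≤ Real.exp (lam * b) * (K * a) := by
  refine (h.norm_sub_le_exp_mul_of_isIntegralCurveOn ha.le hab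
    (hγ.isIntegralCurveOn ha b) hβ).trans ?_
  gcongr
  exact h.norm_sub_le_of_isTrajectory hγ ha.le

lemma eqOn_of_isIntegralCurveOn_of_right_eq (h : SemiconcaveField K lam U v) {γ₁ γ₂ : ℝ → E}
    (ha : 0 < a) (h₁ : IsIntegralCurveOn γ₁ v (Icc a b)) (h₂ : IsIntegralCurveOn γ₂ v (Icc a b))
    (heq : γ₁ b = γ₂ b) : EqOn γ₁ γ₂ (Icc a b) := by
  obtain ⟨L, hL⟩ := h.lipschitz a b (‖γ₁ b‖ + K * (b - a)) ha
  have hball {β : ℝ → E} (hβ : IsIntegralCurveOn β v (Icc a b)) (hβb : β b = γ₁ b) :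
      ∀ s ∈ Ioc a b, β s ∈ Metric.closedBall (0 : E) (‖γ₁ b‖ + K * (b - a)) := by
    intro s hs
    have hspeed := h.norm_sub_le_of_isIntegralCurveOn ha hβ
      (right_mem_Icc.2 (hs.1.le.trans hs.2)) (Ioc_subset_Icc_self hs)
    rw [hβb, abs_sub_comm, abs_of_nonneg (sub_nonneg.2 hs.2)] at hspeed
    have hmono : (K : ℝ) * (b - s) ≤ K * (b - a) := by
      gcongr
      exact hs.1.le
    rw [mem_closedBall_zero_iff]
    linarith [norm_le_norm_add_norm_sub' (β s) (γ₁ b)]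
  have hderiv {β : ℝ → E} (hβ : IsIntegralCurveOn β v (Icc a b)) :
      ∀ s ∈ Ioc a b, HasDerivWithinAt β (v s (β s)) (Iic s) s := fun s hs =>
    (hβ s (Ioc_subset_Icc_self hs)).mono_of_mem_nhdsWithin
      (mem_of_superset (Ioc_mem_nhdsLE hs.1) fun r hr => ⟨hr.1.le, hr.2.trans hs.2⟩)
  exact ODE_solution_unique_of_mem_Icc_left (fun s hs => hL s (Ioc_subset_Icc_self hs))
    (fun s hs => (h₁ s hs).continuousWithinAt) (hderiv h₁) (hball h₁ rfl)
    (fun s hs => (h₂ s hs).continuousWithinAt) (hderiv h₂) (hball h₂ heq.symm) heq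

lemma isPicardLindelof (h : SemiconcaveField K lam U v) (ha : 0 < a) (t₀ : Icc a b) (x : E)
    (r : ℝ≥0) : ∃ R L : ℝ≥0, IsPicardLindelof v t₀ x R r K L := by
  obtain ⟨L, hL⟩ := h.lipschitz a b (‖x‖ + (r + K * (b - a).toNNReal : ℝ≥0)) ha
  refine ⟨r + K * (b - a).toNNReal, L, fun t ht => (hL t ht).mono fun z hz => ?_,
    fun z _ => (h.continuousOn z).mono fun s hs => ha.trans_le hs.1,
    fun t ht z _ => h.norm_le t (ha.trans_le ht.1) z, ?_⟩
  · rw [mem_closedBall_iff_norm] at hz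
    rw [mem_closedBall_zero_iff]
    linarith [norm_le_norm_add_norm_sub' z x]
  · have hat := t₀.2.1
    have htb := t₀.2.2
    push_cast
    rw [add_sub_cancel_left, Real.coe_toNNReal _ (by linarith)]
    gcongr
    exact max_le (by linarith) (by linarith)

lemma hasDerivAt_of_tendsto [CompleteSpace E] {ι : Type*} {l : Filter ι} [l.NeBot]
    (h : SemiconcaveField K lam U v) {A : ι → ℝ → E} {α : ℝ → E}
    (hA : ∀ a b, 0 < a → ∀ᶠ i in l, IsIntegralCurveOn (A i) v (Icc a b))
    (hα : ∀ s, 0 < s → Tendsto (fun i => A i s) l (𝓝 (α s))) (ht : 0 < t) :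
    HasDerivAt α (v t (α t)) t := by
  have ht2 : 0 < t / 2 := half_pos ht
  obtain ⟨R, L, hPL⟩ := h.isPicardLindelof ht2
    ⟨t / 2, left_mem_Icc.2 (by linarith : t / 2 ≤ 2 * t)⟩ (α (t / 2)) 0
  obtain ⟨β, hβ0, hβ⟩ := hPL.exists_eq_forall_mem_Icc_hasDerivWithinAt₀
  have heq : ∀ s ∈ Icc (t / 2) (2 * t), α s = β s := by
    intro s hs
    have hzero : Tendsto (fun i => Real.exp (lam * s) * ‖A i (t / 2) - α (t / 2)‖) l (𝓝 0) := by
      simpa using ((hα (t / 2) ht2).sub_const (α (t / 2))).norm.const_mul (Real.exp (lam * s))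
    have hlim : Tendsto (fun i => A i s - β s) l (𝓝 0) := by
      refine squeeze_zero_norm' ?_ hzero
      filter_upwards [hA (t / 2) s ht2] with i hi
      rw [← hβ0]
      exact h.norm_sub_le_exp_mul_of_isIntegralCurveOn ht2.le hs.1 hi
        (IsIntegralCurveOn.mono hβ (Icc_subset_Icc le_rfl hs.2))
    exact tendsto_nhds_unique (hα s (ht2.trans_le hs.1)) (tendsto_sub_nhds_zero_iff.1 hlim)
  have hnhds : Icc (t / 2) (2 * t) ∈ 𝓝 t := Icc_mem_nhds (by linarith) (by linarith)
  rw [heq t (mem_of_mem_nhds hnhds)]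
  exact ((hβ t (mem_of_mem_nhds hnhds)).hasDerivAt hnhds).congr_of_eventuallyEq
    (mem_of_superset hnhds heq)

lemma cauchySeq_of_isIntegralCurveOn (h : SemiconcaveField K lam U v) {A : ℕ → ℝ → E}
    (hA₀ : ∀ n : ℕ, A n (1 / ((n : ℝ) + 1)) = y)
    (hA : ∀ n : ℕ, IsIntegralCurveOn (A n) v (Icc (1 / ((n : ℝ) + 1)) (n + 1))) {s : ℝ}
    (hs : 0 < s) : CauchySeq fun n => A n s := by
  have hdiff : ∀ m n : ℕ, m ≤ n → s ∈ Icc (1 / ((m : ℝ) + 1)) (m + 1) →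
      ‖A n s - A m s‖ ≤ Real.exp (lam * s) * (K * (1 / ((m : ℝ) + 1))) := by
    intro m n hmn hsm
    have hsub : Icc (1 / ((m : ℝ) + 1)) s ⊆ Icc (1 / ((n : ℝ) + 1)) (n + 1) := by
      refine Icc_subset_Icc (Nat.one_div_le_one_div hmn) (hsm.2.trans ?_)
      gcongr
    refine (h.norm_sub_le_exp_mul_of_isIntegralCurveOn Nat.one_div_pos_of_nat.le hsm.1
      (IsIntegralCurveOn.mono (hA n) hsub)
      (IsIntegralCurveOn.mono (hA m) (Icc_subset_Icc le_rfl hsm.2))).trans ?_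
    rw [hA₀ m, ← hA₀ n]
    gcongr
    exact h.norm_sub_left_le_of_isIntegralCurveOn Nat.one_div_pos_of_nat (hA n)
      (hsub (left_mem_Icc.2 hsm.1))
  have hzero : Tendsto (fun m : ℕ => Real.exp (lam * s) * (K * (1 / ((m : ℝ) + 1)))) atTop
      (𝓝 0) := by
    simpa only [mul_zero] using
      (tendsto_one_div_add_atTop_nhds_zero_nat.const_mul (K : ℝ)).const_mul (Real.exp (lam * s))
  refine Metric.cauchySeq_iff'.2 fun ε hε => ?_
  obtain ⟨N, hN, hN₁, hN₂⟩ := ((hzero.eventually_lt_const hε).and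
    (((tendsto_one_div_add_atTop_nhds_zero_nat (𝕜 := ℝ)).eventually_le_const hs).and
      (tendsto_natCast_atTop_atTop.eventually_ge_atTop s))).exists
  refine ⟨N, fun n hn => ?_⟩
  rw [dist_eq_norm]
  exact (hdiff N n hn ⟨hN₁, by linarith⟩).trans_lt hN

variable [CompleteSpace E]

lemma exists_isIntegralCurveOn (h : SemiconcaveField K lam U v) (ha : 0 < a) (hab : a ≤ b)
    (y : E) : ∃ γ : ℝ → E, γ a = y ∧ IsIntegralCurveOn γ v (Icc a b) := by
  obtain ⟨R, L, hPL⟩ := h.isPicardLindelof ha ⟨a, left_mem_Icc.2 hab⟩ y 0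
  exact hPL.exists_eq_forall_mem_Icc_hasDerivWithinAt₀

-- The field is singular at time `0`, so the trajectory is the limit of the integral curves which
-- leave `y` at the times `1 / (n + 1)`.
lemma exists_isTrajectory (h : SemiconcaveField K lam U v) (y : E) : ∃ γ, IsTrajectory v y γ := by
  have hle (n : ℕ) : 1 / ((n : ℝ) + 1) ≤ n + 1 :=
    (div_le_one_of_le₀ (by simp) (by positivity)).trans (by simp)
  choose A hA₀ hA using fun n : ℕ => h.exists_isIntegralCurveOn Nat.one_div_pos_of_nat (hle n) y
  have hsub (a b : ℝ) (ha : 0 < a) :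
      ∀ᶠ n : ℕ in atTop, Icc a b ⊆ Icc (1 / ((n : ℝ) + 1)) (n + 1) := by
    filter_upwards [(tendsto_one_div_add_atTop_nhds_zero_nat (𝕜 := ℝ)).eventually_le_const ha,
      tendsto_natCast_atTop_atTop.eventually_ge_atTop b] with n hna hnb
    exact Icc_subset_Icc hna (by linarith)
  have hlim : ∀ s, 0 < s → ∃ z, Tendsto (fun n => A n s) atTop (𝓝 z) := fun s hs =>
    cauchySeq_tendsto_of_complete (h.cauchySeq_of_isIntegralCurveOn hA₀ hA hs)
  choose! α hα using hlim
  have hα' : ∀ t, 0 < t → HasDerivAt α (v t (α t)) t := fun t ht =>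
    h.hasDerivAt_of_tendsto (fun a b ha => (hsub a b ha).mono fun n hn =>
      IsIntegralCurveOn.mono (hA n) hn) hα ht
  refine ⟨_, isTrajectory_update (c := K) hα' fun s hs => ?_⟩
  refine le_of_tendsto ((hα s hs).sub_const y).norm ?_
  filter_upwards [hsub s s hs] with n hn
  simpa only [hA₀ n] using h.norm_sub_left_le_of_isIntegralCurveOn Nat.one_div_pos_of_nat (hA n)
    (hn (left_mem_Icc.2 le_rfl))

-- Up to an error `O(δ)`, the initial points in question are the values at time `δ` of the integral
-- curves which end in a ball around `x`: the continuous image of a convex set.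
lemma exists_isPreconnected (h : SemiconcaveField K lam U v) {Z : ℝ → E → E}
    (hZ : ∀ y, IsTrajectory v y fun s => Z s y) {δ r : ℝ} (hδ : 0 < δ) (hδt : δ ≤ t)
    {p₁ p₂ : E} (h₁ : ‖Z t p₁ - x‖ ≤ r) (h₂ : ‖Z t p₂ - x‖ ≤ r) :
    ∃ C : Set E, IsPreconnected C ∧ p₁ ∈ C ∧ p₂ ∈ C ∧
      ∀ q ∈ C, ‖Z t q - x‖ ≤ r + 2 * (Real.exp (lam * t) * (K * δ)) := by
  set κ := Real.exp (lam * t) * (K * δ)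
  have hrκ : 0 ≤ r + κ := add_nonneg ((norm_nonneg _).trans h₁) (by positivity)
  obtain ⟨R, L, hPL⟩ := h.isPicardLindelof hδ ⟨t, right_mem_Icc.2 hδt⟩ x (r + κ).toNNReal
  obtain ⟨α, hα, L', hL'⟩ := hPL.exists_forall_mem_closedBall_eq_hasDerivWithinAt_lipschitzOnWith
  rw [Real.coe_toNNReal _ hrκ] at hα hL'
  have hend : ∀ p, ‖Z t p - x‖ ≤ r → p ∈ (fun z => α z δ) '' Metric.closedBall x (r + κ) := by
    intro p hp
    obtain ⟨γ, rfl, hγ⟩ := h.exists_isIntegralCurveOn hδ hδt p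
    have hclose := h.norm_sub_le_of_isTrajectory_of_isIntegralCurveOn hδ hδt (hZ _) hγ
    have hz : γ t ∈ Metric.closedBall x (r + κ) := by
      rw [norm_sub_rev] at hclose
      rw [mem_closedBall_iff_norm]
      linarith [norm_sub_le_norm_sub_add_norm_sub (γ t) (Z t (γ δ)) x]
    exact ⟨γ t, hz, h.eqOn_of_isIntegralCurveOn_of_right_eq hδ (hα _ hz).2 hγ (hα _ hz).1
      (left_mem_Icc.2 hδt)⟩
  refine ⟨(fun z => α z δ) '' Metric.closedBall x (r + κ), ?_, hend p₁ h₁, hend p₂ h₂, ?_⟩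
  · exact (convex_closedBall x (r + κ)).isPreconnected.image _
      (hL' δ (left_mem_Icc.2 hδt)).continuousOn
  · rintro _ ⟨z, hz, rfl⟩
    have hclose := h.norm_sub_le_of_isTrajectory_of_isIntegralCurveOn hδ hδt (hZ _) (hα z hz).2
    rw [(hα z hz).1] at hclose
    rw [mem_closedBall_iff_norm] at hz
    linarith [norm_sub_le_norm_sub_add_norm_sub (Z t (α z δ)) z x]

end SemiconcaveField

end Flow

/-! ### Exponentially tilted measures -/

section Tilted

variable {α : Type*} [MeasurableSpace α] {μ : Measure α} {f g : α → ℝ} {s : ℝ}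

lemma integral_sub_tilted_le_log_sub_log [NeZero μ] (hf : Integrable (fun a => Real.exp (f a)) μ)
    (hg : Integrable (fun a => Real.exp (g a)) μ)
    (hfg : Integrable (fun a => g a - f a) (μ.tilted f)) :
    ∫ a, (g a - f a) ∂μ.tilted f ≤
      Real.log (∫ a, Real.exp (g a) ∂μ) - Real.log (∫ a, Real.exp (f a) ∂μ) := by
  have := isProbabilityMeasure_tilted hf
  have hexp : Integrable (fun a => Real.exp (g a - f a)) (μ.tilted f) := by
    rw [integrable_tilted_iff hf]
    simpa only [Pi.smul_apply', smul_eq_mul, ← Real.exp_add, add_sub_cancel] using hg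
  have hjensen := convexOn_exp.map_integral_le Real.continuous_exp.continuousOn isClosed_univ
    (Eventually.of_forall fun _ => mem_univ _) hfg hexp
  rw [integral_exp_tilted] at hjensen
  simp only [Pi.add_apply, add_sub_cancel] at hjensen
  rw [← Real.log_div (integral_exp_pos hg).ne' (integral_exp_pos hf).ne']
  exact (Real.le_log_iff_exp_le (div_pos (integral_exp_pos hg) (integral_exp_pos hf))).2 hjensen

lemma abs_exp_div_integral_sub_one_le [IsProbabilityMeasure μ] (hg : AEStronglyMeasurable g μ)
    (hs : ∀ a, |g a| ≤ s) (a : α) :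
    |Real.exp (g a) / (∫ b, Real.exp (g b) ∂μ) - 1| ≤ Real.exp (2 * s) - 1 := by
  have hint : Integrable (fun b => Real.exp (g b)) μ :=
    .of_bound (Real.continuous_exp.comp_aestronglyMeasurable hg) (Real.exp s)
      (Eventually.of_forall fun b => by
        simpa only [Real.norm_eq_abs, Real.abs_exp, Real.exp_le_exp] using (abs_le.1 (hs b)).2)
  have hupper : ∫ b, Real.exp (g b) ∂μ ≤ Real.exp s := by
    simpa using integral_mono hint (integrable_const (Real.exp s))
      fun b => Real.exp_le_exp.2 (abs_le.1 (hs b)).2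
  have hlower : Real.exp (-s) ≤ ∫ b, Real.exp (g b) ∂μ := by
    simpa using integral_mono (integrable_const (Real.exp (-s))) hint
      fun b => Real.exp_le_exp.2 (abs_le.1 (hs b)).1
  have hratio_le : Real.exp (g a) / (∫ b, Real.exp (g b) ∂μ) ≤ Real.exp (2 * s) :=
    calc _ ≤ Real.exp s / Real.exp (-s) := by
          gcongr
          exact (abs_le.1 (hs a)).2
      _ = Real.exp (2 * s) := by rw [← Real.exp_sub]; ring_nf
  have hle_ratio : Real.exp (-(2 * s)) ≤ Real.exp (g a) / (∫ b, Real.exp (g b) ∂μ) :=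
    calc Real.exp (-(2 * s)) = Real.exp (-s) / Real.exp s := by rw [← Real.exp_sub]; ring_nf
      _ ≤ _ := by
          gcongr
          · exact (Real.exp_pos _).trans_le hlower
          · exact (abs_le.1 (hs a)).1
  have hcosh := Real.one_le_cosh (2 * s)
  rw [Real.cosh_eq] at hcosh
  rw [abs_le]
  constructor <;> linarith

variable {F : Type*} [NormedAddCommGroup F] [NormedSpace ℝ F] {v : α → F}

lemma norm_integral_tilted_sub_integral_le [IsProbabilityMeasure μ]
    (hg : AEStronglyMeasurable g μ) (hs : ∀ a, |g a| ≤ s) (hv : Integrable v μ) :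
    ‖(∫ a, v a ∂μ.tilted g) - ∫ a, v a ∂μ‖ ≤ (Real.exp (2 * s) - 1) * ∫ a, ‖v a‖ ∂μ := by
  set r := fun a => Real.exp (g a) / ∫ b, Real.exp (g b) ∂μ with hr
  have hbound := abs_exp_div_integral_sub_one_le hg hs
  have hdiff : Integrable (fun a => (r a - 1) • v a) μ :=
    hv.bdd_smul (Real.exp (2 * s) - 1)
      ((hg.aemeasurable.exp.div_const _).sub_const 1).aestronglyMeasurable
      (Eventually.of_forall hbound)
  have hsplit : (∫ a, v a ∂μ.tilted g) - ∫ a, v a ∂μ = ∫ a, (r a - 1) • v a ∂μ := by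
    rw [integral_tilted, sub_eq_iff_eq_add, ← integral_add hdiff hv]
    simp only [sub_smul, one_smul, sub_add_cancel, hr]
  rw [hsplit, ← integral_const_mul]
  refine norm_integral_le_of_norm_le (hv.norm.const_mul _) (Eventually.of_forall fun a => ?_)
  rw [norm_smul]
  gcongr
  exact hbound a

end Tilted

/-! ### Gaussian integrability -/

section Gaussian

variable {E : Type*} [NormedAddCommGroup E] [InnerProductSpace ℝ E] [FiniteDimensional ℝ E]
  [MeasurableSpace E] [BorelSpace E] {b : ℝ}

lemma integrable_exp_neg_mul_sq_norm (hb : 0 < b) :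
    Integrable fun v : E => Real.exp (-b * ‖v‖ ^ 2) := by
  refine .of_integral_ne_zero ?_
  rw [GaussianFourier.integral_rexp_neg_mul_sq_norm hb]
  positivity

lemma integrable_exp_mul_norm_sub_mul_sq_norm (c : ℝ) (hb : 0 < b) :
    Integrable fun v : E => Real.exp (c * ‖v‖ - b * ‖v‖ ^ 2) := by
  refine ((integrable_exp_neg_mul_sq_norm (half_pos hb)).const_mul
    (Real.exp (c ^ 2 / (2 * b)))).mono' (Continuous.aestronglyMeasurable (by fun_prop))
    (Eventually.of_forall fun v => ?_)
  rw [Real.norm_eq_abs, Real.abs_exp, ← Real.exp_add, Real.exp_le_exp, ← sub_nonneg]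
  have hsquare : c ^ 2 / (2 * b) + -(b / 2) * ‖v‖ ^ 2 - (c * ‖v‖ - b * ‖v‖ ^ 2)
      = (b * ‖v‖ - c) ^ 2 / (2 * b) := by
    field_simp
    ring
  rw [hsquare]
  positivity

end Gaussian

/-! ### The Cole–Hopf potential -/

section ViscousPotential

variable {φ : EuclideanSpace ℝ (Fin d) → ℝ} {K : ℝ≥0} {lam ε t a b A β : ℝ}
  {x x' m : EuclideanSpace ℝ (Fin d)}

/-- The logarithm of the integrand of `viscousPotential`, in terms of the displacement `z = x - y`.
In this variable the Gaussian part does not depend on `x`. -/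
noncomputable def heatExponent (φ : EuclideanSpace ℝ (Fin d) → ℝ) (ε t : ℝ)
    (x z : EuclideanSpace ℝ (Fin d)) : ℝ :=
  -‖z‖ ^ 2 / (2 * ε * t) - φ (x - z) / ε

/-- The Gibbs measure of `viscousPotential`: the probability measure on displacements `z = x - y`
with density proportional to `exp (heatExponent φ ε t x z)`. -/
noncomputable def gibbsMeasure (φ : EuclideanSpace ℝ (Fin d) → ℝ) (ε t : ℝ)
    (x : EuclideanSpace ℝ (Fin d)) : Measure (EuclideanSpace ℝ (Fin d)) :=
  volume.tilted (heatExponent φ ε t x)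

lemma continuous_heatExponent (hφ : Continuous φ) : Continuous (heatExponent φ ε t x) := by
  unfold heatExponent
  fun_prop

lemma heatExponent_le (hK : LipschitzWith K φ) (hε : 0 < ε) (ht : 0 < t) (htb : t ≤ b)
    (z : EuclideanSpace ℝ (Fin d)) :
    heatExponent φ ε t x z ≤ -φ x / ε + (K / ε * ‖z‖ - 1 / (2 * ε * b) * ‖z‖ ^ 2) := by
  have hgauss : 1 / (2 * ε * b) * ‖z‖ ^ 2 ≤ ‖z‖ ^ 2 / (2 * ε * t) := by
    rw [one_div_mul_eq_div]
    gcongr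
  have hφ := le_add_mul_norm_sub_of_lipschitzWith hK x (x - z)
  rw [sub_sub_cancel] at hφ
  have hφε := div_le_div_of_nonneg_right hφ hε.le
  rw [add_div, mul_div_right_comm] at hφε
  rw [heatExponent, neg_div, neg_div]
  linarith

section Integrability

variable {F : Type*} [NormedAddCommGroup F] [NormedSpace ℝ F] {v : EuclideanSpace ℝ (Fin d) → F}

lemma norm_exp_heatExponent_smul_le (hK : LipschitzWith K φ) (hε : 0 < ε) (ht : 0 < t)
    (htb : t ≤ b) (hv : ∀ z, ‖v z‖ ≤ Real.exp ‖z‖) (z : EuclideanSpace ℝ (Fin d)) :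
    ‖Real.exp (heatExponent φ ε t x z) • v z‖ ≤
      Real.exp (-φ x / ε) * Real.exp ((K / ε + 1) * ‖z‖ - 1 / (2 * ε * b) * ‖z‖ ^ 2) := by
  rw [norm_smul, Real.norm_eq_abs, Real.abs_exp, ← Real.exp_add]
  refine (mul_le_mul_of_nonneg_left (hv z) (Real.exp_pos _).le).trans ?_
  rw [← Real.exp_add, Real.exp_le_exp]
  linarith [heatExponent_le (x := x) hK hε ht htb z]

lemma integrable_exp_heatExponent_smul (hK : LipschitzWith K φ) (hε : 0 < ε) (ht : 0 < t)
    (hvc : Continuous v) (hv : ∀ z, ‖v z‖ ≤ Real.exp ‖z‖) :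
    Integrable fun z => Real.exp (heatExponent φ ε t x z) • v z :=
  ((integrable_exp_mul_norm_sub_mul_sq_norm _ (by positivity)).const_mul _).mono'
    ((Real.continuous_exp.comp (continuous_heatExponent hK.continuous)).smul
      hvc).aestronglyMeasurable
    (Eventually.of_forall (norm_exp_heatExponent_smul_le hK hε ht le_rfl hv))

lemma continuousOn_integral_exp_heatExponent_smul (hK : LipschitzWith K φ) (hε : 0 < ε)
    (hvc : Continuous v) (hv : ∀ z, ‖v z‖ ≤ Real.exp ‖z‖) :
    ContinuousOn (fun t => ∫ z, Real.exp (heatExponent φ ε t x z) • v z) (Ioi 0) := by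
  intro t ht
  rw [mem_Ioi] at ht
  refine (continuousAt_of_dominated (bound := fun z => Real.exp (-φ x / ε) *
    Real.exp ((K / ε + 1) * ‖z‖ - 1 / (2 * ε * (2 * t)) * ‖z‖ ^ 2)) ?_ ?_ ?_ ?_).continuousWithinAt
  · exact Eventually.of_forall fun s => ((Real.continuous_exp.comp
      (continuous_heatExponent hK.continuous)).smul hvc).aestronglyMeasurable
  · filter_upwards [Ioo_mem_nhds ht (show t < 2 * t by linarith)] with s hs
    exact Eventually.of_forall (norm_exp_heatExponent_smul_le hK hε hs.1 hs.2.le hv)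
  · exact (integrable_exp_mul_norm_sub_mul_sq_norm _ (by positivity)).const_mul _
  · refine Eventually.of_forall fun z => ContinuousAt.smul ?_ continuousAt_const
    unfold heatExponent
    fun_prop (disch := positivity)

lemma integrable_exp_heatExponent (hK : LipschitzWith K φ) (hε : 0 < ε) (ht : 0 < t)
    (x : EuclideanSpace ℝ (Fin d)) : Integrable fun z => Real.exp (heatExponent φ ε t x z) := by
  simpa only [smul_eq_mul, mul_one] using integrable_exp_heatExponent_smul hK hε ht
    (v := fun _ => (1 : ℝ)) continuous_const (by simp)

lemma isProbabilityMeasure_gibbsMeasure (hK : LipschitzWith K φ) (hε : 0 < ε) (ht : 0 < t) :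
    IsProbabilityMeasure (gibbsMeasure φ ε t x) :=
  isProbabilityMeasure_tilted (integrable_exp_heatExponent hK hε ht x)

lemma integrable_gibbsMeasure (hK : LipschitzWith K φ) (hε : 0 < ε) (ht : 0 < t)
    (hvc : Continuous v) (hv : ∀ z, ‖v z‖ ≤ Real.exp ‖z‖) :
    Integrable v (gibbsMeasure φ ε t x) :=
  (integrable_tilted_iff (integrable_exp_heatExponent hK hε ht x) v).2
    (integrable_exp_heatExponent_smul hK hε ht hvc hv)

lemma continuousOn_integral_gibbsMeasure (hK : LipschitzWith K φ) (hε : 0 < ε)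
    (hvc : Continuous v) (hv : ∀ z, ‖v z‖ ≤ Real.exp ‖z‖) :
    ContinuousOn (fun t => ∫ z, v z ∂gibbsMeasure φ ε t x) (Ioi 0) := by
  have hnormalization := continuousOn_integral_exp_heatExponent_smul (x := x) hK hε
    (v := fun _ => (1 : ℝ)) continuous_const (by simp)
  simp only [smul_eq_mul, mul_one] at hnormalization
  simp only [gibbsMeasure, integral_tilted, div_eq_inv_mul, mul_smul, integral_smul]
  exact (hnormalization.inv₀ fun t ht =>
    (integral_exp_pos (integrable_exp_heatExponent hK hε ht x)).ne').smul
      (continuousOn_integral_exp_heatExponent_smul hK hε hvc hv)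

lemma gibbsMeasure_eq_tilted (hK : LipschitzWith K φ) (hε : 0 < ε) (ht : 0 < t)
    (x x' : EuclideanSpace ℝ (Fin d)) :
    gibbsMeasure φ ε t x' =
      (gibbsMeasure φ ε t x).tilted fun z => (φ (x - z) - φ (x' - z)) / ε := by
  rw [gibbsMeasure, gibbsMeasure, tilted_tilted (integrable_exp_heatExponent hK hε ht x)]
  congr 1
  ext z
  simp only [heatExponent, Pi.add_apply]
  ring

lemma abs_apply_sub_sub_apply_sub_le (hK : LipschitzWith K φ) (x x' z : EuclideanSpace ℝ (Fin d)) :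
    |φ (x - z) - φ (x' - z)| ≤ K * ‖x - x'‖ := by
  simpa [Real.dist_eq, dist_eq_norm] using hK.dist_le_mul (x - z) (x' - z)

lemma norm_integral_gibbsMeasure_sub_le (hK : LipschitzWith K φ) (hε : 0 < ε) (ht : 0 < t)
    (hvc : Continuous v) (hv : ∀ z, ‖v z‖ ≤ Real.exp ‖z‖) (x x' : EuclideanSpace ℝ (Fin d)) :
    ‖(∫ z, v z ∂gibbsMeasure φ ε t x') - ∫ z, v z ∂gibbsMeasure φ ε t x‖ ≤
      (Real.exp (2 * (K * ‖x - x'‖ / ε)) - 1) * ∫ z, ‖v z‖ ∂gibbsMeasure φ ε t x := by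
  have := isProbabilityMeasure_gibbsMeasure (x := x) hK hε ht
  have hφ := hK.continuous
  rw [gibbsMeasure_eq_tilted hK hε ht x x']
  refine norm_integral_tilted_sub_integral_le (Continuous.aestronglyMeasurable (by fun_prop))
    (fun z => ?_) (integrable_gibbsMeasure hK hε ht hvc hv)
  rw [abs_div, abs_of_pos hε]
  gcongr
  exact abs_apply_sub_sub_apply_sub_le hK x x' z

end Integrability

lemma norm_le_exp_norm {E : Type*} [SeminormedAddGroup E] (z : E) : ‖z‖ ≤ Real.exp ‖z‖ := by
  linarith [Real.add_one_le_exp ‖z‖]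

lemma integral_norm_gibbsMeasure_le (hK : LipschitzWith K φ) (hε : 0 < ε) (ht : 0 < t)
    (x : EuclideanSpace ℝ (Fin d)) :
    ∫ z, ‖z‖ ∂gibbsMeasure φ ε t x ≤
      Real.exp (2 * (K * ‖x‖ / ε)) * ∫ z, ‖z‖ ∂gibbsMeasure φ ε t 0 := by
  have h := (le_abs_self _).trans (norm_integral_gibbsMeasure_sub_le hK hε ht continuous_norm
    (fun z => (norm_norm z).trans_le (norm_le_exp_norm z)) 0 x)
  simp only [norm_norm, zero_sub, norm_neg] at h
  linarith

lemma exists_lipschitzOnWith_integral_gibbsMeasure (hK : LipschitzWith K φ) (hε : 0 < ε)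
    (ha : 0 < a) (b R : ℝ) :
    ∃ L : ℝ≥0, ∀ t ∈ Icc a b,
      LipschitzOnWith L (fun x => ∫ z, z ∂gibbsMeasure φ ε t x) (Metric.closedBall 0 R) := by
  have hIoi : Icc a b ⊆ Ioi 0 := fun t ht => ha.trans_le ht.1
  obtain ⟨B, hB⟩ := (isCompact_Icc.image_of_continuousOn
    ((continuousOn_integral_gibbsMeasure (x := 0) hK hε continuous_norm
      fun z => (norm_norm z).trans_le (norm_le_exp_norm z)).mono hIoi)).bddAbove
  set M := Real.exp (2 * (K * R / ε)) * B
  refine ⟨(2 * K / ε * Real.exp (2 * (K * (R + R) / ε)) * M).toNNReal, fun t ht =>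
    LipschitzOnWith.of_dist_le_mul fun x' hx' x hx => ?_⟩
  rw [mem_closedBall_zero_iff] at hx hx'
  have hmean : ∫ z, ‖z‖ ∂gibbsMeasure φ ε t x ≤ M :=
    (integral_norm_gibbsMeasure_le hK hε (hIoi ht) x).trans <|
      mul_le_mul (by gcongr) (hB (mem_image_of_mem _ ht))
        (integral_nonneg fun z => norm_nonneg z) (Real.exp_pos _).le
  have : 0 ≤ M := (integral_nonneg fun z => norm_nonneg z).trans hmean
  have hexp_sub_one : ∀ s : ℝ, Real.exp s - 1 ≤ s * Real.exp s := fun s => by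
    have := mul_le_mul_of_nonneg_right (Real.add_one_le_exp (-s)) (Real.exp_pos s).le
    rw [← Real.exp_add, neg_add_cancel, Real.exp_zero] at this
    linarith
  rw [dist_eq_norm, dist_eq_norm, norm_sub_rev x' x]
  calc _ ≤ (Real.exp (2 * (K * ‖x - x'‖ / ε)) - 1) * ∫ z, ‖z‖ ∂gibbsMeasure φ ε t x :=
        norm_integral_gibbsMeasure_sub_le hK hε (hIoi ht) continuous_id norm_le_exp_norm x x'
    _ ≤ 2 * (K * ‖x - x'‖ / ε) * Real.exp (2 * (K * (R + R) / ε)) * M := by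
        gcongr
        refine (hexp_sub_one _).trans ?_
        gcongr
        exact (norm_sub_le x x').trans (add_le_add hx hx')
    _ = 2 * K / ε * Real.exp (2 * (K * (R + R) / ε)) * M * ‖x - x'‖ := by ring
    _ ≤ _ := by
        gcongr
        exact Real.le_coe_toNNReal _

lemma viscousPotential_eq (hK : LipschitzWith K φ) (hε : 0 < ε) (ht : 0 < t)
    (x : EuclideanSpace ℝ (Fin d)) :
    viscousPotential φ ε t x = ε * (d / 2 * Real.log (2 * Real.pi * ε * t) -
      Real.log (∫ z, Real.exp (heatExponent φ ε t x z))) := by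
  have hdisplacement :
      ∫ y : EuclideanSpace ℝ (Fin d), Real.exp (-‖x - y‖ ^ 2 / (2 * ε * t) - φ y / ε) =
        ∫ z, Real.exp (heatExponent φ ε t x z) := by
    rw [← integral_sub_left_eq_self _ _ x]
    simp only [sub_sub_cancel, heatExponent]
  rw [viscousPotential, hdisplacement, Real.log_mul (by positivity)
    (integral_exp_pos (integrable_exp_heatExponent hK hε ht x)).ne', Real.log_rpow (by positivity)]
  ring

lemma viscousPotential_le_sub_mul_integral (hK : LipschitzWith K φ) (hε : 0 < ε) (ht : 0 < t)
    {g : EuclideanSpace ℝ (Fin d) → ℝ} (hg : Integrable fun z => Real.exp (g z))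
    (hgx' : ∫ z, Real.exp (g z) = ∫ z, Real.exp (heatExponent φ ε t x' z))
    (hgx : Integrable (fun z => g z - heatExponent φ ε t x z) (gibbsMeasure φ ε t x)) :
    viscousPotential φ ε t x' ≤ viscousPotential φ ε t x -
      ε * ∫ z, (g z - heatExponent φ ε t x z) ∂gibbsMeasure φ ε t x := by
  have hgibbs := mul_le_mul_of_nonneg_left
    (integral_sub_tilted_le_log_sub_log (integrable_exp_heatExponent hK hε ht x) hg hgx) hε.le
  rw [hgx', ← gibbsMeasure] at hgibbs
  rw [viscousPotential_eq hK hε ht, viscousPotential_eq hK hε ht]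
  linarith

lemma integrable_apply_sub_sub_apply_sub (hK : LipschitzWith K φ) (hε : 0 < ε) (ht : 0 < t)
    (x₁ x₂ : EuclideanSpace ℝ (Fin d)) :
    Integrable (fun z => φ (x₁ - z) - φ (x₂ - z)) (gibbsMeasure φ ε t x) := by
  have := isProbabilityMeasure_gibbsMeasure (x := x) hK hε ht
  have hφ := hK.continuous
  exact .of_bound (Continuous.aestronglyMeasurable (by fun_prop)) _
    (Eventually.of_forall fun z => abs_apply_sub_sub_apply_sub_le hK x₁ x₂ z)

lemma viscousPotential_le_add_integral (hK : LipschitzWith K φ) (hε : 0 < ε) (ht : 0 < t)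
    (x x' : EuclideanSpace ℝ (Fin d)) :
    viscousPotential φ ε t x' ≤ viscousPotential φ ε t x +
      ∫ z, (φ (x' - z) - φ (x - z)) ∂gibbsMeasure φ ε t x := by
  have hdiff : ∀ z, heatExponent φ ε t x' z - heatExponent φ ε t x z
      = -ε⁻¹ * (φ (x' - z) - φ (x - z)) := fun z => by
    simp only [heatExponent]
    ring
  have h := viscousPotential_le_sub_mul_integral (x := x) hK hε ht
    (integrable_exp_heatExponent hK hε ht x') rfl (by
      simp only [hdiff]
      exact (integrable_apply_sub_sub_apply_sub hK hε ht x' x).const_mul _)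
  simp only [hdiff, integral_const_mul] at h
  rwa [← mul_assoc, mul_neg, mul_inv_cancel₀ hε.ne', neg_one_mul, sub_neg_eq_add] at h

lemma lipschitzWith_viscousPotential (hK : LipschitzWith K φ) (hε : 0 < ε) (ht : 0 < t) :
    LipschitzWith K (viscousPotential φ ε t) := by
  refine LipschitzWith.of_le_add_mul K fun x' x => ?_
  have := isProbabilityMeasure_gibbsMeasure (x := x) hK hε ht
  refine (viscousPotential_le_add_integral hK hε ht x x').trans ?_
  gcongr
  have hmono := integral_mono (integrable_apply_sub_sub_apply_sub (x := x) hK hε ht x' x)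
    (integrable_const (K * ‖x' - x‖))
    fun z => (le_abs_self _).trans (abs_apply_sub_sub_apply_sub_le hK x' x z)
  simpa [dist_eq_norm] using hmono

lemma strongConcaveOn_viscousPotential (hK : LipschitzWith K φ) (hconc : IsLambdaConcave lam φ)
    (hε : 0 < ε) (ht : 0 < t) : StrongConcaveOn univ (-lam) (viscousPotential φ ε t) := by
  have hφ := strongConcaveOn_univ_neg_iff.1 (isLambdaConcave_iff_strongConcaveOn.1 hconc)
  refine strongConcaveOn_univ_neg_iff.2 fun x₀ x₁ a b ha hb hab => ?_
  set x := a • x₀ + b • x₁ with hx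
  have := isProbabilityMeasure_gibbsMeasure (x := x) hK hε ht
  have hint : ∀ x', Integrable (fun z => φ (x' - z) - φ (x - z)) (gibbsMeasure φ ε t x) :=
    fun x' => integrable_apply_sub_sub_apply_sub hK hε ht x' x
  have haverage : a * (∫ z, (φ (x₀ - z) - φ (x - z)) ∂gibbsMeasure φ ε t x) +
      b * ∫ z, (φ (x₁ - z) - φ (x - z)) ∂gibbsMeasure φ ε t x ≤
        a * b * (lam / 2 * ‖x₀ - x₁‖ ^ 2) := by
    rw [← integral_const_mul, ← integral_const_mul,
      ← integral_add ((hint x₀).const_mul a) ((hint x₁).const_mul b)]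
    have hmono := integral_mono (((hint x₀).const_mul a).add ((hint x₁).const_mul b))
      (integrable_const (a * b * (lam / 2 * ‖x₀ - x₁‖ ^ 2))) fun z => ?_
    · simpa using hmono
    · have hφz := hφ (x₀ - z) (x₁ - z) a b ha hb hab
      rw [show a • (x₀ - z) + b • (x₁ - z) = x - (a + b) • z by rw [hx]; module, hab, one_smul,
        sub_sub_sub_cancel_right] at hφz
      simp only [Pi.add_apply]
      linear_combination hφz - φ (x - z) * hab
  have h₀ := mul_le_mul_of_nonneg_left (viscousPotential_le_add_integral hK hε ht x x₀) ha
  have h₁ := mul_le_mul_of_nonneg_left (viscousPotential_le_add_integral hK hε ht x x₁) hb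
  linear_combination h₀ + h₁ + haverage + viscousPotential φ ε t x * hab

-- The Gibbs inequality for the integrand of `x'` shifted by `x' - x`, so that `φ` cancels.
lemma viscousPotential_le_add_inner_add_sq (hK : LipschitzWith K φ) (hε : 0 < ε) (ht : 0 < t)
    (x x' : EuclideanSpace ℝ (Fin d)) :
    viscousPotential φ ε t x' ≤ viscousPotential φ ε t x +
      ⟪t⁻¹ • ∫ z, z ∂gibbsMeasure φ ε t x, x' - x⟫ + 1 / (2 * t) * ‖x' - x‖ ^ 2 := by
  have := isProbabilityMeasure_gibbsMeasure (x := x) hK hε ht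
  have hdiff : ∀ z, heatExponent φ ε t x' (z + (x' - x)) - heatExponent φ ε t x z
      = -(ε * t)⁻¹ * ⟪x' - x, z⟫ - 1 / (2 * ε * t) * ‖x' - x‖ ^ 2 := fun z => by
    rw [heatExponent, heatExponent, norm_add_sq_real, real_inner_comm z,
      show x' - (z + (x' - x)) = x - z by abel]
    field_simp
    ring
  have hmean : Integrable (fun z => z) (gibbsMeasure φ ε t x) :=
    integrable_gibbsMeasure hK hε ht continuous_id norm_le_exp_norm
  have hinner := (hmean.const_inner (x' - x)).const_mul (-(ε * t)⁻¹)
  have h := viscousPotential_le_sub_mul_integral (x := x) hK hε ht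
    ((integrable_exp_heatExponent hK hε ht x').comp_add_right (x' - x))
    (integral_add_right_eq_self (fun z => Real.exp (heatExponent φ ε t x' z)) _) (by
      simp only [hdiff]
      exact hinner.sub (integrable_const _))
  simp only [hdiff] at h
  rw [integral_sub hinner (integrable_const _), integral_const_mul, integral_inner hmean,
    integral_const, probReal_univ, one_smul] at h
  refine h.trans_eq ?_
  rw [real_inner_smul_left, real_inner_comm (x' - x)]
  field_simp
  ring

lemma hasGradientAt_viscousPotential (hK : LipschitzWith K φ) (hε : 0 < ε) (ht : 0 < t)
    (x : EuclideanSpace ℝ (Fin d)) :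
    HasGradientAt (viscousPotential φ ε t) (t⁻¹ • ∫ z, z ∂gibbsMeasure φ ε t x) x := by
  obtain ⟨L, hL⟩ := exists_lipschitzOnWith_integral_gibbsMeasure hK hε ht t (‖x‖ + 1)
  refine hasGradientAt_of_abs_sub_inner_le (c := L / t + 1 / (2 * t)) ?_
  filter_upwards [Metric.closedBall_mem_nhds x one_pos] with x' hx'
  rw [mem_closedBall_iff_norm'] at hx'
  set p := fun x => t⁻¹ • ∫ z, z ∂gibbsMeasure φ ε t x with hp
  have hp_sub : ‖p x - p x'‖ ≤ L / t * ‖x' - x‖ := by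
    have hdist := (hL t ⟨le_rfl, le_rfl⟩).dist_le_mul x (by simp) x' (by
      rw [mem_closedBall_zero_iff]
      linarith [norm_sub_norm_le x' x, norm_sub_rev x' x])
    rw [dist_eq_norm, dist_eq_norm, norm_sub_rev x x'] at hdist
    rw [hp, ← smul_sub, norm_smul, norm_inv, Real.norm_eq_abs, abs_of_pos ht, div_mul_eq_mul_div,
      inv_mul_eq_div]
    gcongr
  have hinner : ⟪p x - p x', x' - x⟫ ≤ L / t * ‖x' - x‖ ^ 2 :=
    (real_inner_le_norm _ _).trans (by
      rw [sq, ← mul_assoc]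
      gcongr)
  have hupper := viscousPotential_le_add_inner_add_sq hK hε ht x x'
  have hlower := viscousPotential_le_add_inner_add_sq hK hε ht x' x
  rw [norm_sub_rev x x', ← neg_sub x' x, inner_neg_right] at hlower
  rw [inner_sub_left] at hinner
  have hL_nonneg : 0 ≤ L / t * ‖x' - x‖ ^ 2 := by positivity
  rw [abs_le]
  constructor <;> linarith

lemma viscousPotential_le (hK : LipschitzWith K φ) (hconc : IsLambdaConcave lam φ) (hε : 0 < ε)
    (ht : 0 < t) (x z : EuclideanSpace ℝ (Fin d)) :
    viscousPotential φ ε t z ≤ viscousPotential φ ε t x +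
      ⟪∇ (viscousPotential φ ε t) x, z - x⟫ + lam / 2 * ‖z - x‖ ^ 2 := by
  have hgrad := hasGradientAt_viscousPotential hK hε ht x
  refine le_add_inner_add_sq_of_strongConcaveOn (strongConcaveOn_viscousPotential hK hconc hε ht)
    (e := fun h => viscousPotential φ ε t (x + h) - viscousPotential φ ε t x -
      ⟪∇ (viscousPotential φ ε t) x, h⟫) ?_ (fun h => by linarith) z
  rw [hgrad.gradient]
  exact hasGradientAt_iff_isLittleO_nhds_zero.1 hgrad

lemma semiconcaveField_viscousPotential (hK : LipschitzWith K φ) (hlam : 0 ≤ lam)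
    (hconc : IsLambdaConcave lam φ) (hε : 0 < ε) :
    SemiconcaveField K lam (viscousPotential φ ε) fun t => ∇ (viscousPotential φ ε t) where
  norm_le t ht x := by
    rw [gradient, LinearIsometryEquiv.norm_map]
    exact norm_fderiv_le_of_lipschitz ℝ (lipschitzWith_viscousPotential hK hε ht)
  lipschitz a b R ha := by
    obtain ⟨L, hL⟩ := exists_lipschitzOnWith_integral_gibbsMeasure hK hε ha b R
    refine ⟨a⁻¹.toNNReal * L, fun t ht => LipschitzOnWith.of_dist_le_mul fun x hx y hy => ?_⟩
    have ht0 : 0 < t := ha.trans_le ht.1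
    rw [(hasGradientAt_viscousPotential hK hε ht0 x).gradient,
      (hasGradientAt_viscousPotential hK hε ht0 y).gradient, dist_smul₀, NNReal.coe_mul, mul_assoc,
      Real.coe_toNNReal _ (by positivity), norm_inv, Real.norm_eq_abs, abs_of_pos ht0]
    gcongr
    · exact ht.1
    · exact (hL t ht).dist_le_mul x hx y hy
  continuousOn x :=
    ((continuousOn_inv₀.mono fun _ ht => (mem_Ioi.1 ht).ne').smul
      (continuousOn_integral_gibbsMeasure hK hε continuous_id norm_le_exp_norm)).congr
      fun _ ht => (hasGradientAt_viscousPotential hK hε ht x).gradient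
  le _ ht := viscousPotential_le hK hconc hε ht
  lam_nonneg := hlam

lemma log_integral_exp_neg_add_mul_sq_norm_sub (hε : 0 < ε) (ht : 0 < t) (hβ : 0 < β) (A : ℝ)
    (m : EuclideanSpace ℝ (Fin d)) :
    Real.log (∫ z, Real.exp (-(A + β * (‖z - m‖ ^ 2 / (2 * t))) / ε)) =
      -A / ε + d / 2 * (Real.log (2 * Real.pi * ε * t) - Real.log β) := by
  have hsplit : ∀ z : EuclideanSpace ℝ (Fin d),
      Real.exp (-(A + β * (‖z - m‖ ^ 2 / (2 * t))) / ε) =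
        Real.exp (-A / ε) * Real.exp (-(β / (2 * t * ε)) * ‖z - m‖ ^ 2) := fun z => by
    rw [← Real.exp_add]
    congr 1
    field_simp
    ring
  simp only [hsplit, integral_const_mul]
  rw [integral_sub_right_eq_self (fun z => Real.exp (-(β / (2 * t * ε)) * ‖z‖ ^ 2)) m,
    GaussianFourier.integral_rexp_neg_mul_sq_norm (by positivity), finrank_euclideanSpace_fin,
    Real.log_mul (by positivity) (by positivity), Real.log_exp, Real.log_rpow (by positivity),
    ← Real.log_div (by positivity) hβ.ne']
  congr 3
  field_simp

lemma integrable_exp_neg_add_mul_sq_norm_sub (hε : 0 < ε) (ht : 0 < t) (hβ : 0 < β) (A : ℝ)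
    (m : EuclideanSpace ℝ (Fin d)) :
    Integrable fun z => Real.exp (-(A + β * (‖z - m‖ ^ 2 / (2 * t))) / ε) := by
  refine (((integrable_exp_neg_mul_sq_norm (b := β / (2 * t * ε)) (by positivity)).comp_sub_right
    m).const_mul (Real.exp (-A / ε))).congr (Eventually.of_forall fun z => ?_)
  simp only [← Real.exp_add]
  congr 1
  field_simp
  ring

lemma heatExponent_eq (φ : EuclideanSpace ℝ (Fin d) → ℝ) (ε t : ℝ)
    (x z : EuclideanSpace ℝ (Fin d)) :
    heatExponent φ ε t x z = -(‖z‖ ^ 2 / (2 * t) + φ (x - z)) / ε := by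
  rw [heatExponent]
  ring

lemma viscousPotential_le_of_forall_le (hK : LipschitzWith K φ) (hε : 0 < ε) (ht : 0 < t)
    (hβ : 0 < β) (h : ∀ z, ‖z‖ ^ 2 / (2 * t) + φ (x - z) ≤ A + β * (‖z - m‖ ^ 2 / (2 * t))) :
    viscousPotential φ ε t x ≤ A + ε * (d / 2 * Real.log β) := by
  have hint := integrable_exp_neg_add_mul_sq_norm_sub hε ht hβ A m
  have hlog := Real.log_le_log (integral_exp_pos hint)
    (integral_mono hint (integrable_exp_heatExponent hK hε ht x) fun z => by
      simp only [heatExponent_eq]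
      exact Real.exp_le_exp.2 (div_le_div_of_nonneg_right (neg_le_neg (h z)) hε.le))
  rw [log_integral_exp_neg_add_mul_sq_norm_sub hε ht hβ] at hlog
  rw [viscousPotential_eq hK hε ht]
  refine (mul_le_mul_of_nonneg_left (sub_le_sub_left hlog _) hε.le).trans_eq ?_
  field_simp
  ring

lemma le_viscousPotential_of_forall_le (hK : LipschitzWith K φ) (hε : 0 < ε) (ht : 0 < t)
    (hβ : 0 < β) (h : ∀ z, A + β * (‖z - m‖ ^ 2 / (2 * t)) ≤ ‖z‖ ^ 2 / (2 * t) + φ (x - z)) :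
    A + ε * (d / 2 * Real.log β) ≤ viscousPotential φ ε t x := by
  have hint := integrable_exp_heatExponent hK hε ht x
  have hlog := Real.log_le_log (integral_exp_pos hint)
    (integral_mono hint (integrable_exp_neg_add_mul_sq_norm_sub hε ht hβ A m) fun z => by
      simp only [heatExponent_eq]
      exact Real.exp_le_exp.2 (div_le_div_of_nonneg_right (neg_le_neg (h z)) hε.le))
  rw [log_integral_exp_neg_add_mul_sq_norm_sub hε ht hβ] at hlog
  rw [viscousPotential_eq hK hε ht]
  refine Eq.trans_le ?_ (mul_le_mul_of_nonneg_left (sub_le_sub_left hlog _) hε.le)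
  field_simp
  ring

lemma viscousPotential_le_hopfLax_add (hK : LipschitzWith K φ) (hlam : 0 ≤ lam)
    (hconc : IsLambdaConcave lam φ) (hε : 0 < ε) (ht : 0 < t) (x : EuclideanSpace ℝ (Fin d)) :
    viscousPotential φ ε t x ≤
      hopfLax φ t x + ε * (d / 2 * Real.log (2 * (1 + t * lam))) := by
  obtain ⟨y, hy⟩ := exists_isFoot ht.le hK x
  have hlower : ∀ z, psi φ t y + ⟪x, z - y⟫ ≤ psi φ t z := fun z => by
    have := hy ▸ inner_sub_psi_le_w ht.le hK x z
    rw [inner_sub_right]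
    linarith
  have hupper := le_add_inner_add_sq_of_affine_le (strongConcaveOn_psi ht.le hconc) hlower
  refine viscousPotential_le_of_forall_le (m := x - y) hK hε ht (by positivity) fun z => ?_
  have hφ := sq_norm_sub_div_add_eq (φ := φ) ht.ne' x (x - z)
  rw [sub_sub_cancel] at hφ
  rw [hφ, (isFoot_iff_hopfLax_eq ht hK).1 hy, sq_norm_sub_div_add_eq ht.ne',
    show 2 * (1 + t * lam) * (‖z - (x - y)‖ ^ 2 / (2 * t)) = (1 + t * lam) * ‖z - (x - y)‖ ^ 2 / t
      by field_simp, ← add_div]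
  refine div_le_div_of_nonneg_right ?_ ht.le
  have hz := hupper (x - z)
  rw [inner_sub_right, show x - z - y = -(z - (x - y)) by abel, norm_neg] at hz
  linarith

lemma hopfLax_sub_le_viscousPotential (hK : LipschitzWith K φ) (hε : 0 < ε) (hε' : ε ≤ 1 / 2)
    (ht : 0 < t) (x : EuclideanSpace ℝ (Fin d)) :
    hopfLax φ t x - ε * (K ^ 2 * t) + ε * (d / 2 * Real.log ε) ≤ viscousPotential φ ε t x := by
  refine le_viscousPotential_of_forall_le (m := 0) hK hε ht hε fun z => ?_
  have hhopf := hopfLax_le ht hK x (x - z + ε • z)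
  have hφ := le_add_mul_norm_sub_of_lipschitzWith hK (x - z + ε • z) (x - z)
  rw [show x - (x - z + ε • z) = (1 - ε) • z by module, norm_smul,
    Real.norm_of_nonneg (by linarith)] at hhopf
  rw [add_sub_cancel_left, norm_smul, Real.norm_of_nonneg hε.le] at hφ
  have hsplit : ‖z‖ ^ 2 / (2 * t) + ε * (K ^ 2 * t)
      - (((1 - ε) * ‖z‖) ^ 2 / (2 * t) + K * (ε * ‖z‖) + ε * (‖z‖ ^ 2 / (2 * t)))
      = ε * (1 - 2 * ε) * ‖z‖ ^ 2 / (4 * t) + ε * (‖z‖ - 2 * K * t) ^ 2 / (4 * t) := by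
    field_simp
    ring
  have hnonneg : 0 ≤ ε * (1 - 2 * ε) * ‖z‖ ^ 2 / (4 * t)
      + ε * (‖z‖ - 2 * K * t) ^ 2 / (4 * t) := by
    have : 0 ≤ 1 - 2 * ε := by linarith
    positivity
  rw [sub_zero]
  linarith

lemma exists_abs_viscousPotential_sub_hopfLax_le (hK : LipschitzWith K φ) (hlam : 0 ≤ lam)
    (hconc : IsLambdaConcave lam φ) (τ : ℝ) :
    ∃ η : ℝ → ℝ, Tendsto η (𝓝[>] 0) (𝓝 0) ∧ ∀ ε, 0 < ε → ε ≤ 1 / 2 → ∀ t, 0 < t → t ≤ τ →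
      ∀ x, |viscousPotential φ ε t x - hopfLax φ t x| ≤ η ε := by
  refine ⟨fun ε => ε * (K ^ 2 * τ + d / 2 * Real.log (2 * (1 + τ * lam)))
    - d / 2 * (Real.log ε * ε), ?_, fun ε hε hε' t ht htτ x => ?_⟩
  · have hlinear : Tendsto (fun ε : ℝ => ε * (K ^ 2 * τ + d / 2 * Real.log (2 * (1 + τ * lam))))
        (𝓝[>] 0) (𝓝 (0 * (K ^ 2 * τ + d / 2 * Real.log (2 * (1 + τ * lam))))) :=
      (tendsto_id.mul_const _).mono_left nhdsWithin_le_nhds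
    have hlog := (tendsto_log_mul_rpow_nhdsGT_zero (zero_lt_one' ℝ)).const_mul ((d : ℝ) / 2)
    simp only [Real.rpow_one] at hlog
    simpa using hlinear.sub hlog
  · have hupper := viscousPotential_le_hopfLax_add hK hlam hconc hε ht x
    have hlower := hopfLax_sub_le_viscousPotential hK hε hε' ht x
    have hlogβ_mono : ε * (d / 2 * Real.log (2 * (1 + t * lam))) ≤
        ε * (d / 2 * Real.log (2 * (1 + τ * lam))) := by gcongr
    have hlogβ_nonneg : 0 ≤ ε * (d / 2 * Real.log (2 * (1 + t * lam))) := by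
      have : 0 ≤ Real.log (2 * (1 + t * lam)) :=
        Real.log_nonneg (by linarith [mul_nonneg ht.le hlam])
      positivity
    have hlogε : ε * (d / 2 * Real.log ε) ≤ 0 :=
      mul_nonpos_of_nonneg_of_nonpos hε.le (mul_nonpos_of_nonneg_of_nonpos (by positivity)
        (Real.log_nonpos hε.le (by linarith)))
    have hK_mono : ε * (K ^ 2 * t) ≤ ε * (K ^ 2 * τ) := by gcongr
    have hK_nonneg : 0 ≤ ε * (K ^ 2 * t) := by positivity
    rw [abs_le]
    constructor <;> linarith

end ViscousPotential

/-! ### The zero viscosity limit of the flow -/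

section AdhesionFlow

variable {φ : EuclideanSpace ℝ (Fin d) → ℝ} {K : ℝ≥0} {lam ε t s : ℝ}
  {x y : EuclideanSpace ℝ (Fin d)}

lemma IsViscousFlow.isTrajectory {Z : ℝ → EuclideanSpace ℝ (Fin d) → EuclideanSpace ℝ (Fin d)}
    (h : IsViscousFlow φ ε Z) (y : EuclideanSpace ℝ (Fin d)) :
    IsTrajectory (fun t => ∇ (viscousPotential φ ε t)) y fun s => Z s y :=
  h y

lemma exists_isViscousFlow (hK : LipschitzWith K φ) (hlam : 0 ≤ lam)
    (hconc : IsLambdaConcave lam φ) (hε : 0 < ε) : ∃ Z, IsViscousFlow φ ε Z := by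
  choose γ hγ using fun y =>
    (semiconcaveField_viscousPotential hK hlam hconc hε).exists_isTrajectory y
  exact ⟨fun t y => γ y t, hγ⟩

lemma norm_viscousFlow_sub_sq_le (hK : LipschitzWith K φ) (hlam : 0 ≤ lam)
    (hconc : IsLambdaConcave lam φ) {ε₁ ε₂ η : ℝ} (hε₁ : 0 < ε₁) (hε₂ : 0 < ε₂)
    {Z₁ Z₂ : ℝ → EuclideanSpace ℝ (Fin d) → EuclideanSpace ℝ (Fin d)}
    (h₁ : IsViscousFlow φ ε₁ Z₁) (h₂ : IsViscousFlow φ ε₂ Z₂) (ht : 0 ≤ t) (hη0 : 0 ≤ η)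
    (hη : ∀ s ∈ Ioo 0 t, ∀ z, |viscousPotential φ ε₁ s z - viscousPotential φ ε₂ s z| ≤ η)
    (y : EuclideanSpace ℝ (Fin d)) :
    ‖Z₁ t y - Z₂ t y‖ ^ 2 ≤ Real.exp (2 * lam * t) * (4 * η * t) := by
  have hstability := norm_sub_sq_le_of_supergradient ht
    ((h₁.isTrajectory y).continuousOn t) ((h₂.isTrajectory y).continuousOn t)
    (fun s hs => (h₁ y).2.2 s hs.1) (fun s hs => (h₂ y).2.2 s hs.1)
    (fun s hs => viscousPotential_le hK hconc hε₁ hs.1 _)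
    (fun s hs => viscousPotential_le hK hconc hε₂ hs.1 _) hη hlam hη0
  simpa [(h₁ y).1, (h₂ y).1] using hstability

lemma exists_norm_viscousFlow_sub_sq_le (hK : LipschitzWith K φ) (hlam : 0 ≤ lam)
    (hconc : IsLambdaConcave lam φ) (ht : 0 ≤ t) :
    ∃ θ : ℝ → ℝ, Tendsto θ (𝓝[>] 0) (𝓝 0) ∧
      ∀ ε₁ ∈ Ioc (0 : ℝ) (1 / 2), ∀ ε₂ ∈ Ioc (0 : ℝ) (1 / 2), ∀ Z₁ Z₂,
        IsViscousFlow φ ε₁ Z₁ → IsViscousFlow φ ε₂ Z₂ →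
        ∀ y, ‖Z₁ t y - Z₂ t y‖ ^ 2 ≤ θ ε₁ + θ ε₂ := by
  obtain ⟨η, hη_lim, hη⟩ := exists_abs_viscousPotential_sub_hopfLax_le hK hlam hconc t
  refine ⟨fun ε => Real.exp (2 * lam * t) * (4 * |η ε| * t), ?_, ?_⟩
  · simpa using ((hη_lim.abs.const_mul 4).mul_const t).const_mul (Real.exp (2 * lam * t))
  · intro ε₁ hε₁ ε₂ hε₂ Z₁ Z₂ h₁ h₂ y
    refine (norm_viscousFlow_sub_sq_le hK hlam hconc hε₁.1 hε₂.1 h₁ h₂ ht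
      (η := |η ε₁| + |η ε₂|) (by positivity) (fun s hs z => ?_) y).trans_eq (by ring)
    refine (abs_sub_le _ (hopfLax φ s z) _).trans (add_le_add ?_ ?_)
    · exact (hη ε₁ hε₁.1 hε₁.2 s hs.1 hs.2.le z).trans (le_abs_self _)
    · rw [abs_sub_comm]
      exact (hη ε₂ hε₂.1 hε₂.2 s hs.1 hs.2.le z).trans (le_abs_self _)

lemma exists_isAdhesionFlow (hK : LipschitzWith K φ) (hlam : 0 ≤ lam)
    (hconc : IsLambdaConcave lam φ) : ∃ X, IsAdhesionFlow φ X := by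
  choose! Xe hXe using fun ε (hε : 0 < ε) => exists_isViscousFlow hK hlam hconc hε
  have hlim : ∀ t, 0 ≤ t → ∀ y, ∃ z, Tendsto (fun ε => Xe ε t y) (𝓝[>] 0) (𝓝 z) := by
    intro t ht y
    obtain ⟨θ, hθ_lim, hθ⟩ := exists_norm_viscousFlow_sub_sq_le hK hlam hconc ht
    refine cauchy_map_iff_exists_tendsto.1 (Metric.cauchy_iff.2 ⟨inferInstance, fun κ hκ => ?_⟩)
    have hsmall : ∀ᶠ ε in 𝓝[>] (0 : ℝ), ε ∈ Ioc 0 (1 / 2) ∧ θ ε < κ ^ 2 / 2 :=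
      Filter.Eventually.and (Ioc_mem_nhdsGT (by norm_num))
        (hθ_lim.eventually_lt_const (by positivity))
    refine ⟨_, image_mem_map hsmall, ?_⟩
    rintro _ ⟨ε₁, ⟨hε₁, hθ₁⟩, rfl⟩ _ ⟨ε₂, ⟨hε₂, hθ₂⟩, rfl⟩
    rw [dist_eq_norm]
    refine lt_of_pow_lt_pow_left₀ 2 hκ.le ?_
    linarith [hθ ε₁ hε₁ ε₂ hε₂ _ _ (hXe ε₁ hε₁.1) (hXe ε₂ hε₂.1) y]
  choose! X hX using hlim
  exact ⟨X, Xe, hXe, hX⟩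

variable {X : ℝ → EuclideanSpace ℝ (Fin d) → EuclideanSpace ℝ (Fin d)}

lemma IsAdhesionFlow.lipschitzWith (hX : IsAdhesionFlow φ X) (hK : LipschitzWith K φ)
    (hlam : 0 ≤ lam) (hconc : IsLambdaConcave lam φ) (ht : 0 ≤ t) :
    LipschitzWith (Real.exp (lam * t)).toNNReal (X t) := by
  obtain ⟨Xe, hXe, hlim⟩ := hX
  refine LipschitzWith.of_dist_le_mul fun y z => ?_
  rw [Real.coe_toNNReal _ (Real.exp_pos _).le, dist_eq_norm, dist_eq_norm]
  refine le_of_tendsto ((hlim t ht y).sub (hlim t ht z)).norm ?_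
  filter_upwards [self_mem_nhdsWithin] with ε hε
  have hfield := semiconcaveField_viscousPotential hK hlam hconc hε
  have hle := hfield.norm_sub_le_exp_mul_of_isTrajectory
    ((hXe ε hε).isTrajectory y) ((hXe ε hε).isTrajectory z) ht
  exact hle

lemma IsAdhesionFlow.norm_sub_le (hX : IsAdhesionFlow φ X) (hK : LipschitzWith K φ)
    (hlam : 0 ≤ lam) (hconc : IsLambdaConcave lam φ) (ht : 0 ≤ t)
    (y : EuclideanSpace ℝ (Fin d)) : ‖X t y - y‖ ≤ K * t := by
  obtain ⟨Xe, hXe, hlim⟩ := hX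
  refine le_of_tendsto ((hlim t ht y).sub_const y).norm ?_
  filter_upwards [self_mem_nhdsWithin] with ε hε
  have hfield := semiconcaveField_viscousPotential hK hlam hconc hε
  have hle := hfield.norm_sub_le_of_isTrajectory ((hXe ε hε).isTrajectory y) ht
  exact hle

lemma IsAdhesionFlow.exists_norm_viscousFlow_sub_le (hX : IsAdhesionFlow φ X)
    (hK : LipschitzWith K φ) (hlam : 0 ≤ lam) (hconc : IsLambdaConcave lam φ) (ht : 0 ≤ t)
    {κ : ℝ} (hκ : 0 < κ) :
    ∃ ε > 0, ∃ Z, IsViscousFlow φ ε Z ∧ ∀ y, ‖Z t y - X t y‖ ≤ κ := by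
  obtain ⟨Xe, hXe, hlim⟩ := hX
  obtain ⟨θ, hθ_lim, hθ⟩ := exists_norm_viscousFlow_sub_sq_le hK hlam hconc ht
  have hsmall : ∀ᶠ ε in 𝓝[>] (0 : ℝ), ε ∈ Ioc 0 (1 / 2) ∧ θ ε < κ ^ 2 :=
    Filter.Eventually.and (Ioc_mem_nhdsGT (by norm_num))
      (hθ_lim.eventually_lt_const (by positivity))
  obtain ⟨ε, hε, hθε⟩ := hsmall.exists
  refine ⟨ε, hε.1, Xe ε, hXe ε hε.1, fun y => le_of_sq_le_sq ?_ hκ.le⟩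
  rw [← add_zero (θ ε)] at hθε
  refine le_trans ?_ hθε.le
  refine le_of_tendsto_of_tendsto ((tendsto_const_nhds.sub (hlim t ht y)).norm.pow 2)
    (hθ_lim.const_add (θ ε)) ?_
  filter_upwards [Ioc_mem_nhdsGT (show (0 : ℝ) < 1 / 2 by norm_num)] with ε' hε'
  exact hθ ε hε ε' hε' _ _ (hXe ε hε.1) (hXe ε' hε'.1) y

lemma isLittleO_const_mul_sq_norm {E : Type*} [NormedAddCommGroup E] (c : ℝ) :
    (fun h : E => c * ‖h‖ ^ 2) =o[𝓝 0] fun h => h :=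
  (((Asymptotics.isLittleO_pow_id (𝕜 := ℝ) one_lt_two).comp_tendsto
    tendsto_norm_zero).const_mul_left c).of_norm_right

lemma IsFoot.hopfLax_le_add_inner_add_sq (h : IsFoot φ t x y) (hK : LipschitzWith K φ)
    (hconc : IsLambdaConcave lam φ) (ht : 0 < t) (hs : 0 < s) (hst : s ≤ t)
    (z : EuclideanSpace ℝ (Fin d)) :
    hopfLax φ s z ≤ hopfLax φ s (y + s • t⁻¹ • (x - y))
      + ⟪t⁻¹ • (x - y), z - (y + s • t⁻¹ • (x - y))⟫
      + lam / 2 * ‖z - (y + s • t⁻¹ • (x - y))‖ ^ 2 := by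
  have hfoot := (isFoot_iff_hopfLax_eq hs hK).1 (h.isFoot_of_le ht hK hs.le hst)
  refine le_add_inner_add_sq_of_strongConcaveOn (strongConcaveOn_hopfLax hs hK hconc)
    (isLittleO_const_mul_sq_norm (2 * s)⁻¹) (fun k => ?_) z
  generalize t⁻¹ • (x - y) = p at hfoot ⊢
  refine (hopfLax_le hs hK (y + s • p + k) y).trans_eq ?_
  rw [hfoot, show y + s • p + k - y = s • p + k by abel, add_sub_cancel_left, norm_add_sq_real,
    real_inner_smul_left]
  field_simp
  ring

lemma IsFoot.norm_viscousFlow_sub_sq_le (h : IsFoot φ t x y) (hK : LipschitzWith K φ)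
    (hlam : 0 ≤ lam) (hconc : IsLambdaConcave lam φ) (ht : 0 < t) (hs : 0 ≤ s) (hst : s ≤ t)
    (hε : 0 < ε) {Z : ℝ → EuclideanSpace ℝ (Fin d) → EuclideanSpace ℝ (Fin d)}
    (hZ : IsViscousFlow φ ε Z) {η : ℝ} (hη0 : 0 ≤ η)
    (hη : ∀ r ∈ Ioo 0 s, ∀ z, |viscousPotential φ ε r z - hopfLax φ r z| ≤ η) :
    ‖Z s y - (y + s • t⁻¹ • (x - y))‖ ^ 2 ≤ Real.exp (2 * lam * s) * (4 * η * s) := by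
  have hstability := norm_sub_sq_le_of_supergradient (γ₂ := fun r => y + r • t⁻¹ • (x - y))
    hs ((hZ.isTrajectory y).continuousOn s) (by fun_prop)
    (fun r hr => (hZ y).2.2 r hr.1)
    (fun r _ => by simpa using ((hasDerivAt_id' r).smul_const (t⁻¹ • (x - y))).const_add y)
    (fun r hr => viscousPotential_le hK hconc hε hr.1 _)
    (fun r hr => h.hopfLax_le_add_inner_add_sq hK hconc ht hr.1 (hr.2.le.trans hst))
    hη hlam hη0
  simpa [(hZ y).1] using hstability

lemma IsAdhesionFlow.eq_of_isFoot (hX : IsAdhesionFlow φ X) (hK : LipschitzWith K φ)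
    (hlam : 0 ≤ lam) (hconc : IsLambdaConcave lam φ) (ht : 0 < t) (h : IsFoot φ t x y)
    (hs : 0 ≤ s) (hst : s ≤ t) : X s y = y + s • t⁻¹ • (x - y) := by
  obtain ⟨Xe, hXe, hlim⟩ := hX
  obtain ⟨η, hη_lim, hη⟩ := exists_abs_viscousPotential_sub_hopfLax_le hK hlam hconc t
  refine tendsto_nhds_unique (hlim s hs y) (tendsto_iff_norm_sub_tendsto_zero.2 ?_)
  have hbound : Tendsto (fun ε => Real.exp (2 * lam * s) * (4 * |η ε| * s)) (𝓝[>] 0) (𝓝 0) := by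
    simpa using ((hη_lim.abs.const_mul 4).mul_const s).const_mul (Real.exp (2 * lam * s))
  have hsq : Tendsto (fun ε => ‖Xe ε s y - (y + s • t⁻¹ • (x - y))‖ ^ 2) (𝓝[>] 0) (𝓝 0) := by
    refine squeeze_zero' (Eventually.of_forall fun _ => by positivity) ?_ hbound
    filter_upwards [Ioc_mem_nhdsGT (show (0 : ℝ) < 1 / 2 by norm_num)] with ε hε
    exact h.norm_viscousFlow_sub_sq_le hK hlam hconc ht hs hst hε.1 (hXe ε hε.1) (abs_nonneg _)
      fun r hr z => (hη ε hε.1 hε.2 r hr.1 (hr.2.le.trans hst) z).trans (le_abs_self _)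
  simpa [Real.sqrt_sq (norm_nonneg _)] using hsq.sqrt

/-! ### Fibres of the limit flow -/

lemma IsAdhesionFlow.exists_isPreconnected (hX : IsAdhesionFlow φ X) (hK : LipschitzWith K φ)
    (hlam : 0 ≤ lam) (hconc : IsLambdaConcave lam φ) (ht : 0 < t)
    {p₁ p₂ : EuclideanSpace ℝ (Fin d)} (h₁ : X t p₁ = x) (h₂ : X t p₂ = x) {κ : ℝ} (hκ : 0 < κ) :
    ∃ C : Set (EuclideanSpace ℝ (Fin d)), IsPreconnected C ∧ p₁ ∈ C ∧ p₂ ∈ C ∧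
      ∀ q ∈ C, ‖X t q - x‖ ≤ κ := by
  obtain ⟨ε, hε, Z, hZ, hclose⟩ :=
    hX.exists_norm_viscousFlow_sub_le hK hlam hconc ht.le (show 0 < κ / 4 by positivity)
  have hδ_small : ∀ᶠ δ in 𝓝[>] (0 : ℝ), δ ∈ Ioc 0 t ∧
      2 * (Real.exp (lam * t) * (K * δ)) < κ / 2 := by
    have hlim : Tendsto (fun δ : ℝ => 2 * (Real.exp (lam * t) * (K * δ))) (𝓝[>] 0)
        (𝓝 (2 * (Real.exp (lam * t) * (K * 0)))) :=
      (((tendsto_id.const_mul _).const_mul _).const_mul _).mono_left nhdsWithin_le_nhds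
    simp only [mul_zero] at hlim
    exact Filter.Eventually.and (Ioc_mem_nhdsGT ht) (hlim.eventually_lt_const (by positivity))
  obtain ⟨δ, hδ, hδκ⟩ := hδ_small.exists
  obtain ⟨C, hC, hp₁, hp₂, hq⟩ :=
    (semiconcaveField_viscousPotential hK hlam hconc hε).exists_isPreconnected
      hZ.isTrajectory hδ.1 hδ.2 (h₁ ▸ hclose p₁) (h₂ ▸ hclose p₂)
  refine ⟨C, hC, hp₁, hp₂, fun q hqC => ?_⟩
  have htriangle := norm_sub_le_norm_sub_add_norm_sub (X t q) (Z t q) x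
  rw [norm_sub_rev (X t q) (Z t q)] at htriangle
  linarith [hq q hqC, hclose q]

lemma IsAdhesionFlow.exists_apply_eq (hX : IsAdhesionFlow φ X) (hK : LipschitzWith K φ)
    (hlam : 0 ≤ lam) (hconc : IsLambdaConcave lam φ) (ht : 0 < t)
    {p₁ p₂ : EuclideanSpace ℝ (Fin d)} (h₁ : X t p₁ = x) (h₂ : X t p₂ = x) {i : Fin d} {c : ℝ}
    (hc₁ : p₁ i ≤ c) (hc₂ : c ≤ p₂ i) : ∃ q, X t q = x ∧ q i = c := by
  have hcoord : Continuous fun q : EuclideanSpace ℝ (Fin d) => q i := by fun_prop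
  have happrox : ∀ κ : ℝ, 0 < κ →
      ∃ q : EuclideanSpace ℝ (Fin d), q i = c ∧ ‖X t q - x‖ ≤ κ := by
    intro κ hκ
    obtain ⟨C, hC, hp₁, hp₂, hq⟩ := hX.exists_isPreconnected hK hlam hconc ht h₁ h₂ hκ
    obtain ⟨q, hqC, hqc⟩ := hC.intermediate_value hp₁ hp₂ hcoord.continuousOn ⟨hc₁, hc₂⟩
    exact ⟨q, hqc, hq q hqC⟩
  have hball : ∀ q, ‖X t q - x‖ ≤ 1 → q ∈ Metric.closedBall x (1 + K * t) := by
    intro q hq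
    rw [mem_closedBall_iff_norm]
    have htriangle := norm_sub_le_norm_sub_add_norm_sub q (X t q) x
    rw [norm_sub_rev q (X t q)] at htriangle
    linarith [hX.norm_sub_le hK hlam hconc ht.le q]
  have hcompact : IsCompact (Metric.closedBall x (1 + K * t) ∩ {q | q i = c}) :=
    (isCompact_closedBall _ _).inter_right (isClosed_eq hcoord continuous_const)
  have hcont := (hX.lipschitzWith hK hlam hconc ht.le).continuous
  obtain ⟨q₁, hq₁, hq₁x⟩ := happrox 1 one_pos
  obtain ⟨q, hq, hmin⟩ := hcompact.exists_isMinOn (f := fun q => ‖X t q - x‖)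
    ⟨q₁, hball q₁ hq₁x, hq₁⟩ (by fun_prop)
  refine ⟨q, sub_eq_zero.1 (norm_le_zero_iff.1 (le_of_forall_pos_le_add fun κ hκ => ?_)), hq.2⟩
  obtain ⟨q', hq', hq'x⟩ := happrox (min κ 1) (by positivity)
  have hle : ‖X t q - x‖ ≤ ‖X t q' - x‖ := hmin ⟨hball q' (hq'x.trans (min_le_right _ _)), hq'⟩
  rw [zero_add]
  exact hle.trans (hq'x.trans (min_le_left _ _))

lemma measure_image_eq_zero_of_lipschitzWith {E : Type*} [NormedAddCommGroup E]
    [NormedSpace ℝ E] [FiniteDimensional ℝ E] [MeasurableSpace E] [BorelSpace E] {μ : Measure E}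
    [μ.IsAddHaarMeasure] {L : ℝ≥0} {f : E → E} (hf : LipschitzWith L f) {A : Set E}
    (hA : μ A = 0) : μ (f '' A) = 0 := by
  have hhausdorff : Measure.hausdorffMeasure (Module.finrank ℝ E) ≪ μ :=
    Measure.absolutelyContinuous_isAddHaarMeasure _ _
  have hhaar : μ ≪ Measure.hausdorffMeasure (Module.finrank ℝ E) :=
    Measure.absolutelyContinuous_isAddHaarMeasure _ _
  refine hhaar (le_antisymm ?_ zero_le)
  refine (hf.hausdorffMeasure_image_le (Nat.cast_nonneg _) A).trans ?_
  rw [hhausdorff hA, mul_zero]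

lemma volume_setOf_apply_eq {ι : Type*} [Fintype ι] (i : ι) (c : ℝ) :
    volume {q : EuclideanSpace ℝ ι | q i = c} = 0 := by
  rw [← Measure.pi_hyperplane (fun _ : ι => (volume : Measure ℝ)) i c]
  exact (PiLp.volume_preserving_ofLp ι).measure_preimage
    (s := {q : ι → ℝ | q i = c})
    (measurableSet_eq_fun (by fun_prop) measurable_const).nullMeasurableSet

-- Each coordinate maps a fibre onto an interval; if it is nondegenerate it contains a rational `c`,
-- and the images under `X t` of the countably many hyperplanes `{q | q i = c}` are null.
lemma IsAdhesionFlow.ae_fiber_subsingleton (hX : IsAdhesionFlow φ X) (hK : LipschitzWith K φ)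
    (hlam : 0 ≤ lam) (hconc : IsLambdaConcave lam φ) (ht : 0 < t) :
    ∀ᵐ x : EuclideanSpace ℝ (Fin d), (X t ⁻¹' {x}).Subsingleton := by
  have hnull : ∀ (i : Fin d) (c : ℚ),
      ∀ᵐ x : EuclideanSpace ℝ (Fin d), x ∉ X t '' {q | q i = (c : ℝ)} := fun i c =>
    measure_eq_zero_iff_ae_notMem.1
      (measure_image_eq_zero_of_lipschitzWith (hX.lipschitzWith hK hlam hconc ht.le)
        (volume_setOf_apply_eq i c))
  filter_upwards [ae_all_iff.2 fun i => ae_all_iff.2 (hnull i)] with x hx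
  have hle : ∀ p₁ p₂, X t p₁ = x → X t p₂ = x → ∀ i, p₂ i ≤ p₁ i := by
    intro p₁ p₂ h₁ h₂ i
    by_contra! hlt
    obtain ⟨c, hc₁, hc₂⟩ := exists_rat_btwn hlt
    obtain ⟨q, hq, hqc⟩ := hX.exists_apply_eq hK hlam hconc ht h₁ h₂ hc₁.le hc₂.le
    exact hx i c ⟨q, hqc, hq⟩
  intro p₁ h₁ p₂ h₂
  ext i
  exact le_antisymm (hle p₂ p₁ h₂ h₁ i) (hle p₁ p₂ h₁ h₂ i)

lemma IsFoot.T_eq (h : IsFoot φ t x y) (hK : LipschitzWith K φ) (hlam : 0 ≤ lam)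
    (hconc : IsLambdaConcave lam φ) (ht : 0 < t) (hs : 0 ≤ s) (hst : s ≤ t) :
    T φ s y = y + s • t⁻¹ • (x - y) :=
  (T_eq_iff hs hK hlam hconc).2 ((h.isFoot_of_le ht hK hs hst).mem_subgradient hs hK)

lemma IsAdhesionFlow.ae_free_streaming (hX : IsAdhesionFlow φ X) (hK : LipschitzWith K φ)
    (hlam : 0 ≤ lam) (hconc : IsLambdaConcave lam φ) (ht : 0 < t) :
    ∀ᵐ x : EuclideanSpace ℝ (Fin d), ∃ y ∈ Sigma φ t,
      X t ⁻¹' {x} = {y} ∧ T φ t ⁻¹' {x} = {y} ∧ DifferentiableAt ℝ φ y ∧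
      ∀ s : ℝ, 0 ≤ s → s ≤ t → X s y = T φ s y ∧ T φ s y = y + s • ∇ φ y := by
  filter_upwards [hX.ae_fiber_subsingleton hK hlam hconc ht, ae_differentiableAt_w ht hK]
    with x hfiber hx
  have hfoot : IsFoot φ t x (∇ (w φ t) x) :=
    (legendreAttained_psi ht.le hK).legendre_eq_gradient hx
  have hgrad := hfoot.hasGradientAt ht hK hconc
  refine ⟨∇ (w φ t) x, gradient_w_mem_Sigma ht.le hK hx,
    hfiber.eq_singleton_of_mem ?_,
    T_preimage_of_differentiableAt ht.le hK hlam hconc hx, hgrad.differentiableAt, ?_⟩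
  · rw [mem_preimage, mem_singleton_iff, hX.eq_of_isFoot hK hlam hconc ht hfoot ht.le le_rfl,
      smul_inv_smul₀ ht.ne', add_sub_cancel]
  · intro s hs hst
    rw [hX.eq_of_isFoot hK hlam hconc ht hfoot hs hst, hfoot.T_eq hK hlam hconc ht hs hst,
      hgrad.gradient]
    exact ⟨rfl, rfl⟩

end AdhesionFlow

/-! ### Push-forwards of Lebesgue measure -/

lemma isProperMap_of_norm_sub_le {E : Type*} [NormedAddCommGroup E] [ProperSpace E] {f : E → E}
    {C : ℝ} (hf : Continuous f) (hC : ∀ y, ‖f y - y‖ ≤ C) : IsProperMap f := by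
  refine isProperMap_iff_tendsto_cocompact.2 ⟨hf, ?_⟩
  rw [← Metric.cobounded_eq_cocompact, ← tendsto_norm_atTop_iff_cobounded]
  refine tendsto_atTop_mono (fun y => ?_)
    (tendsto_atTop_add_const_right _ (-C) tendsto_norm_cobounded_atTop)
  have hnorm := norm_sub_norm_le y (f y)
  rw [norm_sub_rev] at hnorm
  linarith [hC y]

lemma sigmaFinite_map_of_isProperMap {α β : Type*} [TopologicalSpace α] [MeasurableSpace α]
    [OpensMeasurableSpace α] [TopologicalSpace β] [T2Space β] [SigmaCompactSpace β]
    [MeasurableSpace β] [BorelSpace β] {μ : Measure α} [IsFiniteMeasureOnCompacts μ] {f : α → β}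
    (hf : IsProperMap f) : SigmaFinite (μ.map f) := by
  have : IsFiniteMeasureOnCompacts (μ.map f) := by
    refine ⟨fun C hC => ?_⟩
    rw [Measure.map_apply hf.continuous.measurable hC.measurableSet]
    exact (hf.isCompact_preimage hC).measure_lt_top
  infer_instance

lemma rnDeriv_restrict_of_ae_mem {α : Type*} [MeasurableSpace α] {μ ν : Measure α}
    [μ.HaveLebesgueDecomposition ν] [SigmaFinite ν] {s : Set α} (hs : MeasurableSet s)
    (h : ∀ᵐ x ∂ν, x ∈ s) : (μ.restrict s).rnDeriv ν =ᵐ[ν] μ.rnDeriv ν := by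
  filter_upwards [Measure.rnDeriv_restrict μ ν hs, h] with x hx hxs
  rw [hx, indicator_of_mem hxs]

lemma rnDeriv_map_congr {α β : Type*} [MeasurableSpace α] [MeasurableSpace β] {μ : Measure α}
    {ν : Measure β} [SigmaFinite ν] {f g : α → β} (hf : Measurable f) (hg : Measurable g)
    [(μ.map f).HaveLebesgueDecomposition ν] [(μ.map g).HaveLebesgueDecomposition ν]
    (h : ∀ᵐ x ∂ν, f ⁻¹' {x} = g ⁻¹' {x}) : (μ.map f).rnDeriv ν =ᵐ[ν] (μ.map g).rnDeriv ν := by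
  obtain ⟨s, hs, hsm, hsν⟩ := exists_measurable_superset_of_null (mem_ae_iff.1 h)
  have hs_ae : ∀ᵐ x ∂ν, x ∈ sᶜ := measure_eq_zero_iff_ae_notMem.1 hsν
  have hrestrict : (μ.map f).restrict sᶜ = (μ.map g).restrict sᶜ := by
    ext B hB
    rw [Measure.restrict_apply hB, Measure.restrict_apply hB,
      Measure.map_apply hf (hB.inter hsm.compl), Measure.map_apply hg (hB.inter hsm.compl),
      ← biUnion_preimage_singleton f, ← biUnion_preimage_singleton g]
    congr 1
    exact iUnion₂_congr fun x hx => by_contra fun hne => hx.2 (hs hne)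
  have hf_ae := rnDeriv_restrict_of_ae_mem (μ := μ.map f) hsm.compl hs_ae
  rw [hrestrict] at hf_ae
  exact hf_ae.symm.trans (rnDeriv_restrict_of_ae_mem hsm.compl hs_ae)

section ChangeOfVariables

variable {E : Type*} [NormedAddCommGroup E] [NormedSpace ℝ E] [FiniteDimensional ℝ E]
  [MeasurableSpace E] [BorelSpace E] {μ : Measure E} [μ.IsAddHaarMeasure]
  {f g : E → E} {f' : E → E →L[ℝ] E} {s : Set E}

lemma restrict_map_image_eq_withDensity (hf : Measurable f) (hs : MeasurableSet s)
    (hf' : ∀ y ∈ s, HasFDerivWithinAt f (f' y) s y) (hdet : ∀ y ∈ s, (f' y).det ≠ 0)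
    (hg : ∀ y, f y ∈ f '' s → g (f y) = y) :
    (μ.map f).restrict (f '' s) =
      (μ.restrict (f '' s)).withDensity fun x => (ENNReal.ofReal |(f' (g x)).det|)⁻¹ := by
  have hgs : ∀ y ∈ s, g (f y) = y := fun y hy => hg y (mem_image_of_mem f hy)
  have hinj : InjOn f s := fun y hy z hz hyz => by rw [← hgs y hy, hyz, hgs z hz]
  have hpre : f ⁻¹' (f '' s) = s := by
    refine Subset.antisymm (fun y hy => ?_) (subset_preimage_image f s)
    obtain ⟨z, hz, hzy⟩ := id hy
    rwa [← hg y hy, ← hzy, hgs z hz]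
  have himage := measurable_image_of_fderivWithin hs hf' hinj
  ext B hB
  have hsB : MeasurableSet (s ∩ f ⁻¹' B) := hs.inter (hf hB)
  rw [Measure.restrict_apply hB, Measure.map_apply hf (hB.inter himage), preimage_inter, hpre,
    withDensity_apply _ hB, Measure.restrict_restrict hB, inter_comm B, inter_comm _ s,
    ← image_inter_preimage,
    lintegral_image_eq_lintegral_abs_det_fderiv_mul μ hsB
      (fun y hy => (hf' y hy.1).mono inter_subset_left) (hinj.mono inter_subset_left),
    ← setLIntegral_one]
  refine setLIntegral_congr_fun hsB fun y hy => ?_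
  have hpos := abs_pos.2 (hdet y hy.1)
  simp only [hgs y hy.1]
  rw [ENNReal.mul_inv_cancel (ENNReal.ofReal_pos.2 hpos).ne' ENNReal.ofReal_ne_top]

lemma rnDeriv_map_eq_inv_abs_det [(μ.map f).HaveLebesgueDecomposition μ] (hf : Measurable f)
    (hs : MeasurableSet s) (hf' : ∀ y ∈ s, HasFDerivWithinAt f (f' y) s y)
    (hdet : ∀ y ∈ s, (f' y).det ≠ 0) (hg : ∀ y, f y ∈ f '' s → g (f y) = y)
    (hae : ∀ᵐ x ∂μ, x ∈ f '' s) (hfg : Measurable fun x => f' (g x)) :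
    (μ.map f).rnDeriv μ =ᵐ[μ] fun x => (ENNReal.ofReal |(f' (g x)).det|)⁻¹ := by
  have hinj : InjOn f s := fun y hy z hz hyz => by
    rw [← hg y (mem_image_of_mem f hy), hyz, hg z (mem_image_of_mem f hz)]
  have hrestrict := rnDeriv_restrict_of_ae_mem (μ := μ.map f)
    (measurable_image_of_fderivWithin hs hf' hinj) hae
  rw [restrict_map_image_eq_withDensity hf hs hf' hdet hg,
    Measure.restrict_eq_self_of_ae_mem hae] at hrestrict
  have hdensity : Measurable fun x => (ENNReal.ofReal |(f' (g x)).det|)⁻¹ :=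
    ((ContinuousLinearMap.continuous_det.measurable.comp hfg).abs).ennreal_ofReal.inv
  exact hrestrict.symm.trans (Measure.rnDeriv_withDensity μ hdensity)

end ChangeOfVariables

/-! ### The Monge–Ampère measure -/

section MongeAmpere

variable {φ : EuclideanSpace ℝ (Fin d) → ℝ} {K : ℝ≥0} {lam t : ℝ}
  {x y : EuclideanSpace ℝ (Fin d)}

lemma isProperMap_T (ht : 0 ≤ t) (hK : LipschitzWith K φ) (hlam : 0 ≤ lam)
    (hconc : IsLambdaConcave lam φ) : IsProperMap (T φ t) :=
  isProperMap_of_norm_sub_le (lipschitzWith_T ht hK hlam hconc).continuous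
    (norm_T_sub_le ht hK hlam hconc)

lemma isMongeAmpereMeasure_map_T (ht : 0 ≤ t) (hK : LipschitzWith K φ) (hlam : 0 ≤ lam)
    (hconc : IsLambdaConcave lam φ) :
    IsMongeAmpereMeasure (w φ t) (Measure.map (T φ t) volume) := by
  intro B hB
  rw [Measure.map_apply (lipschitzWith_T ht hK hlam hconc).continuous.measurable hB]
  congr 1
  ext y
  simp only [mem_preimage, mem_iUnion, exists_prop, ← T_eq_iff ht hK hlam hconc, exists_eq_right']

/-- The points `y` where `T_t` is differentiable and nondegenerate, and `w_t` is differentiable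
at `T_t y`. These are the points at which the inverse function theorem yields the Hessian
of `w_t`. -/
def regularSet (φ : EuclideanSpace ℝ (Fin d) → ℝ) (t : ℝ) : Set (EuclideanSpace ℝ (Fin d)) :=
  {y | DifferentiableAt ℝ (w φ t) (T φ t y) ∧ DifferentiableAt ℝ (T φ t) y ∧
    (fderiv ℝ (T φ t) y).det ≠ 0}

lemma measurableSet_regularSet (ht : 0 ≤ t) (hK : LipschitzWith K φ) (hlam : 0 ≤ lam)
    (hconc : IsLambdaConcave lam φ) : MeasurableSet (regularSet φ t) := by
  have hT := (lipschitzWith_T ht hK hlam hconc).continuous.measurable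
  have hdet : Measurable fun y => (fderiv ℝ (T φ t) y).det :=
    ContinuousLinearMap.continuous_det.measurable.comp (measurable_fderiv ℝ (T φ t))
  exact (hT (measurableSet_of_differentiableAt ℝ (w φ t))).inter
    ((measurableSet_of_differentiableAt ℝ (T φ t)).inter (hdet (measurableSet_singleton 0).compl))

lemma gradient_w_T (ht : 0 ≤ t) (hK : LipschitzWith K φ) (hlam : 0 ≤ lam)
    (hconc : IsLambdaConcave lam φ) (hy : DifferentiableAt ℝ (w φ t) (T φ t y)) :
    ∇ (w φ t) (T φ t y) = y :=
  (eq_gradient_of_mem_subgradient hy (mem_subgradient_T ht hK hlam hconc y)).symm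

lemma T_gradient_w (ht : 0 ≤ t) (hK : LipschitzWith K φ) (hlam : 0 ≤ lam)
    (hconc : IsLambdaConcave lam φ) (hx : DifferentiableAt ℝ (w φ t) x) :
    T φ t (∇ (w φ t) x) = x :=
  (T_eq_iff ht hK hlam hconc).2
    ((legendreAttained_psi ht hK).gradient_legendre_mem_subgradient hx)

lemma ae_gradient_w_mem_regularSet (ht : 0 < t) (hK : LipschitzWith K φ) (hlam : 0 ≤ lam)
    (hconc : IsLambdaConcave lam φ) :
    ∀ᵐ x : EuclideanSpace ℝ (Fin d), DifferentiableAt ℝ (w φ t) x ∧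
      ∇ (w φ t) x ∈ regularSet φ t := by
  have hT := lipschitzWith_T ht.le hK hlam hconc
  have hnondiff : volume (T φ t '' {y | ¬ DifferentiableAt ℝ (T φ t) y}) = 0 :=
    measure_image_eq_zero_of_lipschitzWith hT (ae_iff.1 hT.ae_differentiableAt)
  have hsard : volume (T φ t '' {y | DifferentiableAt ℝ (T φ t) y ∧
      (fderiv ℝ (T φ t) y).det = 0}) = 0 :=
    addHaar_image_eq_zero_of_det_fderivWithin_eq_zero volume
      (fun y hy => hy.1.hasFDerivAt.hasFDerivWithinAt) fun y hy => hy.2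
  filter_upwards [ae_differentiableAt_w ht hK, measure_eq_zero_iff_ae_notMem.1 hnondiff,
    measure_eq_zero_iff_ae_notMem.1 hsard] with x hx hxdiff hxdet
  have hTx := T_gradient_w ht.le hK hlam hconc hx
  have hdiff : DifferentiableAt ℝ (T φ t) (∇ (w φ t) x) :=
    by_contra fun hnot => hxdiff ⟨_, hnot, hTx⟩
  exact ⟨hx, hTx.symm ▸ hx, hdiff, fun hdet => hxdet ⟨_, ⟨hdiff, hdet⟩, hTx⟩⟩

lemma rnDeriv_map_T (ht : 0 < t) (hK : LipschitzWith K φ) (hlam : 0 ≤ lam)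
    (hconc : IsLambdaConcave lam φ) :
    (Measure.map (T φ t) volume).rnDeriv volume =ᵐ[volume]
      fun x => (ENNReal.ofReal |(fderiv ℝ (T φ t) (∇ (w φ t) x)).det|)⁻¹ := by
  have := sigmaFinite_map_of_isProperMap (μ := volume) (isProperMap_T ht.le hK hlam hconc)
  refine rnDeriv_map_eq_inv_abs_det (lipschitzWith_T ht.le hK hlam hconc).continuous.measurable
    (measurableSet_regularSet ht.le hK hlam hconc)
    (fun y hy => hy.2.1.hasFDerivAt.hasFDerivWithinAt) (fun y hy => hy.2.2) ?_ ?_ ?_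
  · rintro y ⟨z, hz, hzy⟩
    exact gradient_w_T ht.le hK hlam hconc (hzy ▸ hz.1)
  · filter_upwards [ae_gradient_w_mem_regularSet ht hK hlam hconc] with x hx
    exact ⟨_, hx.2, T_gradient_w ht.le hK hlam hconc hx.1⟩
  · exact (measurable_fderiv ℝ (T φ t)).comp
      ((InnerProductSpace.toDual ℝ _).symm.continuous.measurable.comp
        (measurable_fderiv ℝ (w φ t)))

end MongeAmpere

/-! ### Second order expansions of conjugate functions -/

section SecondOrder

variable {E : Type*} [NormedAddCommGroup E] [InnerProductSpace ℝ E]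
  {g : E → ℝ} {S : E → E} {A : E →L[ℝ] E} {y : E}

lemma inner_apply_nonneg_of_monotone (hS : ∀ u v, 0 ≤ ⟪u - v, S u - S v⟫)
    (hA : HasFDerivAt S A y) (u : E) : 0 ≤ ⟪u, A u⟫ := by
  have hline : HasDerivAt (fun s : ℝ => S (y + s • u)) (A u) 0 := hA.hasLineDerivAt u
  have hinner : HasDerivAt (fun s : ℝ => ⟪u, S (y + s • u)⟫) ⟪u, A u⟫ 0 := by
    simpa using (hasDerivAt_const (0 : ℝ) u).inner ℝ hline
  refine hinner.nonneg_of_monotone fun a b hab => ?_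
  rcases hab.eq_or_lt with rfl | hab
  · exact le_rfl
  have hmono := hS (y + b • u) (y + a • u)
  rw [add_sub_add_left_eq_sub, ← sub_smul, inner_smul_left, inner_sub_right] at hmono
  exact sub_nonneg.1 (nonneg_of_mul_nonneg_right hmono (by simpa using hab))

lemma isLittleO_inner {α : Type*} {l : Filter α} {p q r : α → E} (hp : p =o[l] r)
    (hq : q =O[l] r) : (fun a => ⟪p a, q a⟫) =o[l] fun a => ‖r a‖ ^ 2 := by
  have hmul := hp.norm_norm.mul_isBigO hq.norm_norm
  refine (Asymptotics.IsBigO.of_bound 1 (Eventually.of_forall fun a => ?_)).trans_isLittleO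
    (hmul.congr_right fun a => (sq _).symm)
  rw [one_mul, norm_mul, norm_norm, norm_norm]
  exact norm_inner_le_norm _ _

variable [CompleteSpace E]

lemma isSymmetric_of_hasGradientAt (hg : ∀ z, HasGradientAt g (S z) z) (hA : HasFDerivAt S A y)
    (u v : E) : ⟪A u, v⟫ = ⟪u, A v⟫ := by
  have hderiv : HasFDerivAt (fun z => innerSL ℝ (S z)) ((innerSL ℝ).comp A) y :=
    (innerSL ℝ : E →L[ℝ] E →L[ℝ] ℝ).hasFDerivAt.comp y hA
  have hsymm : ⟪A u, v⟫ = ⟪A v, u⟫ :=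
    second_derivative_symmetric (f := g) (fun z => (hg z).hasFDerivAt) hderiv u v
  rw [hsymm, real_inner_comm]

lemma hasFDerivAt_second_order_remainder (hg : ∀ z, HasGradientAt g (S z) z)
    (hA : ∀ u v, ⟪A u, v⟫ = ⟪u, A v⟫) (k : E) :
    HasFDerivAt (fun k => g (y + k) - g y - ⟪S y, k⟫ - 1 / 2 * ⟪A k, k⟫)
      (innerSL ℝ (S (y + k) - S y - A k)) k := by
  have hshift : HasFDerivAt (fun k => g (y + k)) (innerSL ℝ (S (y + k))) k :=
    (hg (y + k)).hasFDerivAt.comp k ((hasFDerivAt_id k).const_add y)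
  have hquad := (A.hasFDerivAt (x := k)).inner ℝ (hasFDerivAt_id k)
  refine (((hshift.sub_const (g y)).sub (innerSL ℝ (S y)).hasFDerivAt).sub
    (hquad.const_mul (1 / 2))).congr_fderiv ?_
  ext v
  simp only [sub_apply, smul_apply, innerSL_apply_apply,
    ContinuousLinearMap.comp_apply, ContinuousLinearMap.prod_apply, fderivInnerCLM_apply,
    ContinuousLinearMap.id_apply, id_eq, smul_eq_mul, inner_sub_left]
  rw [hA v k, real_inner_comm (A k) v]
  ring

lemma isLittleO_second_order (hg : ∀ z, HasGradientAt g (S z) z) (hA : HasFDerivAt S A y) :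
    (fun k => g (y + k) - g y - ⟪S y, k⟫ - 1 / 2 * ⟪A k, k⟫) =o[𝓝 0] fun k => ‖k‖ ^ 2 := by
  have hderiv := hasFDerivAt_second_order_remainder (y := y) hg (isSymmetric_of_hasGradientAt hg hA)
  rw [Asymptotics.isLittleO_iff]
  intro c hc
  obtain ⟨δ, hδ, hball⟩ := Metric.eventually_nhds_iff_ball.1
    (Asymptotics.isLittleO_iff.1 (hasFDerivAt_iff_isLittleO_nhds_zero.1 hA) hc)
  filter_upwards [Metric.ball_mem_nhds (0 : E) hδ] with k hk
  have hbound : ∀ z ∈ Metric.closedBall (0 : E) ‖k‖,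
      ‖innerSL ℝ (S (y + z) - S y - A z)‖ ≤ c * ‖k‖ := by
    intro z hz
    rw [mem_closedBall_zero_iff] at hz
    rw [innerSL_apply_norm]
    exact (hball z (mem_ball_zero_iff.2 (hz.trans_lt (mem_ball_zero_iff.1 hk)))).trans (by gcongr)
  have hmean := (convex_closedBall (0 : E) ‖k‖).norm_image_sub_le_of_norm_hasFDerivWithin_le
    (fun z _ => (hderiv z).hasFDerivWithinAt) hbound
    (Metric.mem_closedBall_self (norm_nonneg k)) (mem_closedBall_zero_iff.2 le_rfl)
  simp only [add_zero, inner_zero_right, map_zero, mul_zero, sub_zero, sub_self] at hmean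
  rwa [mul_assoc, ← sq, ← norm_norm k, ← norm_pow] at hmean

/- With `k = Y (S y + h) - y` and `r = k - e⁻¹ h = o(h)`, conjugacy gives
`f (S y + h) - f (S y) - ⟪y, h⟫ - ⟪h, e⁻¹ h⟫ / 2 = -⟪e r, r⟫ / 2 - R k`, where `R` is the second
order remainder of `g` at `y`. -/
lemma isLittleO_second_order_conjugate {f : E → ℝ} {e : E ≃L[ℝ] E} {Y : E → E}
    (hg : ∀ z, HasGradientAt g (S z) z) (he : HasFDerivAt S (e : E →L[ℝ] E) y)
    (hf : ∀ z, f (S z) = ⟪z, S z⟫ - g z) (hSY : ∀ x, S (Y x) = x) (hYS : Y (S y) = y)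
    (hY : ContinuousAt Y (S y)) :
    (fun h => f (S y + h) - f (S y) - ⟪y, h⟫ - 1 / 2 * ⟪h, e.symm h⟫)
      =o[𝓝 0] fun h => ‖h‖ ^ 2 := by
  have hsymm : ∀ u v, ⟪e u, v⟫ = ⟪u, e v⟫ := isSymmetric_of_hasGradientAt hg he
  have hYderiv : HasFDerivAt Y (e.symm : E →L[ℝ] E) (S y) :=
    HasFDerivAt.of_local_left_inverse hY (hYS.symm ▸ he) (Eventually.of_forall hSY)
  have hr : (fun h => Y (S y + h) - y - e.symm h) =o[𝓝 0] fun h : E => h := by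
    simpa only [hYS, ContinuousLinearEquiv.coe_coe] using
      hasFDerivAt_iff_isLittleO_nhds_zero.1 hYderiv
  have hk : (fun h => Y (S y + h) - y) =O[𝓝 0] fun h : E => h := by
    simpa only [ContinuousLinearEquiv.coe_coe, sub_add_cancel] using
      hr.isBigO.add ((e.symm : E →L[ℝ] E).isBigO_comp (fun h => h) (𝓝 0))
  have hk_tendsto : Tendsto (fun h => Y (S y + h) - y) (𝓝 0) (𝓝 0) := hk.trans_tendsto tendsto_id
  have hremainder :=
    ((isLittleO_second_order hg he).comp_tendsto hk_tendsto).trans_isBigO (hk.norm_norm.pow 2)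
  have hquad := isLittleO_inner
    (((e : E →L[ℝ] E).isBigO_comp _ (𝓝 0)).trans_isLittleO hr) hr.isBigO
  refine ((hquad.const_mul_left (-1 / 2)).sub hremainder).congr_left fun h => ?_
  have hfh := hf (Y (S y + h))
  rw [hSY] at hfh
  have hcross : ⟪e (Y (S y + h) - y), e.symm h⟫ = ⟪Y (S y + h) - y, h⟫ := by
    rw [hsymm, e.apply_symm_apply]
  simp only [Function.comp_apply, ContinuousLinearEquiv.coe_coe, add_sub_cancel, hfh, hf y,
    map_sub e _ (e.symm h), e.apply_symm_apply, inner_sub_left (e _),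
    inner_sub_right _ _ (e.symm h), hcross]
  simp only [inner_sub_left, inner_sub_right, inner_add_right, real_inner_comm]
  ring

end SecondOrder

lemma continuousAt_rightInverse_of_isClosedMap {α β : Type*} [TopologicalSpace α]
    [TopologicalSpace β] {f : α → β} {g : β → α} {x : β} (hf : IsClosedMap f)
    (hg : Function.RightInverse g f) (hx : f ⁻¹' {x} = {g x}) : ContinuousAt g x := by
  intro U hU
  have hfiber := hf.eventually_nhds_fiber (p := (· ∈ U)) x fun z hz => by
    rwa [mem_singleton_iff.1 (hx.subset hz)]
  exact hfiber.mono fun z hz => hz (g z) (hg z)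

lemma exists_posSemidef_toEuclideanLin_eq_symm {ι : Type*} [Fintype ι] [DecidableEq ι]
    {e : EuclideanSpace ℝ ι ≃L[ℝ] EuclideanSpace ℝ ι} (hsymm : ∀ u v, ⟪e u, v⟫ = ⟪u, e v⟫)
    (hpos : ∀ u, 0 ≤ ⟪u, e u⟫) :
    ∃ H : Matrix ι ι ℝ, H.PosSemidef ∧ (∀ h, Matrix.toEuclideanLin H h = e.symm h) ∧
      H.det = (e : EuclideanSpace ℝ ι →L[ℝ] EuclideanSpace ℝ ι).det⁻¹ := by
  obtain ⟨H, hH⟩ := Matrix.toEuclideanLin.surjective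
    (e.symm : EuclideanSpace ℝ ι →L[ℝ] EuclideanSpace ℝ ι).toLinearMap
  have happly : ∀ h, Matrix.toEuclideanLin H h = e.symm h := fun h => LinearMap.congr_fun hH h
  refine ⟨H, Matrix.isPositive_toEuclideanLin_iff.1 ⟨fun u v => ?_, fun u => ?_⟩, happly, ?_⟩
  · simpa only [happly, e.apply_symm_apply] using (hsymm (e.symm u) (e.symm v)).symm
  · simpa only [happly, e.apply_symm_apply, RCLike.re_to_real] using hpos (e.symm u)
  · rw [← LinearMap.det_toLin (EuclideanSpace.basisFun ι ℝ).toBasis H,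
      ← Matrix.toEuclideanLin_eq_toLin_orthonormal, hH]
    exact ContinuousLinearEquiv.det_coe_symm e

section Alexandrov

variable {φ : EuclideanSpace ℝ (Fin d) → ℝ} {K : ℝ≥0} {lam t : ℝ}
  {y : EuclideanSpace ℝ (Fin d)}

lemma surjective_T (ht : 0 ≤ t) (hK : LipschitzWith K φ) (hlam : 0 ≤ lam)
    (hconc : IsLambdaConcave lam φ) : Function.Surjective (T φ t) := fun x =>
  let ⟨z, hz⟩ := exists_isFoot ht hK x
  ⟨z, (T_eq_iff ht hK hlam hconc).2 (hz.mem_subgradient ht hK)⟩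

lemma exists_continuousAt_rightInverse_T (ht : 0 ≤ t) (hK : LipschitzWith K φ) (hlam : 0 ≤ lam)
    (hconc : IsLambdaConcave lam φ) (hy : DifferentiableAt ℝ (w φ t) (T φ t y)) :
    ∃ Y, Function.RightInverse Y (T φ t) ∧ Y (T φ t y) = y ∧ ContinuousAt Y (T φ t y) := by
  have hfiber : T φ t ⁻¹' {T φ t y} = {y} := by
    rw [T_preimage_of_differentiableAt ht hK hlam hconc hy, gradient_w_T ht hK hlam hconc hy]
  obtain ⟨Y, hTY⟩ := (surjective_T ht hK hlam hconc).hasRightInverse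
  have hYT : Y (T φ t y) = y := hfiber.subset (hTY _)
  exact ⟨Y, hTY, hYT, continuousAt_rightInverse_of_isClosedMap
    (isProperMap_T ht hK hlam hconc).isClosedMap hTY (hYT.symm ▸ hfiber)⟩

lemma exists_hasAlexandrovHessianAt (ht : 0 ≤ t) (hK : LipschitzWith K φ) (hlam : 0 ≤ lam)
    (hconc : IsLambdaConcave lam φ) (hy : y ∈ regularSet φ t) :
    ∃ H : Matrix (Fin d) (Fin d) ℝ, HasAlexandrovHessianAt (w φ t) H (T φ t y) ∧
      ENNReal.ofReal H.det = (ENNReal.ofReal |(fderiv ℝ (T φ t) y).det|)⁻¹ := by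
  obtain ⟨hw, hT, hdet⟩ := hy
  obtain ⟨e, he⟩ : ∃ e : EuclideanSpace ℝ (Fin d) ≃L[ℝ] EuclideanSpace ℝ (Fin d),
      (e : EuclideanSpace ℝ (Fin d) →L[ℝ] EuclideanSpace ℝ (Fin d)) = fderiv ℝ (T φ t) y :=
    ⟨_, ContinuousLinearMap.coe_toContinuousLinearEquivOfDetNeZero _ hdet⟩
  have hTe := hT.hasFDerivAt
  rw [← he] at hTe hdet ⊢
  have hgrad := hasGradientAt_psiConv ht hK hlam hconc
  have hmono : ∀ u v, 0 ≤ ⟪u - v, T φ t u - T φ t v⟫ := fun u v =>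
    le_trans (by positivity) (norm_T_sub_sq_le_inner ht hK hlam hconc u v)
  obtain ⟨H, hHpos, hHe, hHdet⟩ := exists_posSemidef_toEuclideanLin_eq_symm
    (isSymmetric_of_hasGradientAt hgrad hTe) (inner_apply_nonneg_of_monotone hmono hTe)
  obtain ⟨Y, hTY, hYT, hYcont⟩ := exists_continuousAt_rightInverse_T ht hK hlam hconc hw
  have hconj : ∀ z, w φ t (T φ t z) = ⟪z, T φ t z⟫ - psiConv φ t z := fun z => by
    have hpsiConv : psiConv φ t z = ⟪z, T φ t z⟫ - w φ t (T φ t z) :=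
      (legendreAttained_w ht hK).mem_subgradient_iff.1 (mem_subgradient_T ht hK hlam hconc z)
    rw [hpsiConv, sub_sub_cancel]
  refine ⟨H, ⟨Matrix.isHermitian_iff_isSymm.1 hHpos.isHermitian, hw, ?_⟩, ?_⟩
  · simpa only [gradient_w_T ht hK hlam hconc hw, hHe] using
      isLittleO_second_order_conjugate hgrad hTe hconj hTY hYT hYcont
  · rw [← abs_of_nonneg hHpos.det_nonneg, hHdet, abs_inv,
      ENNReal.ofReal_inv_of_pos (abs_pos.2 hdet)]

end Alexandrov

end Adhesion

open Adhesion

theorem theorem5 (d : ℕ) (φ : EuclideanSpace ℝ (Fin d) → ℝ) (K : ℝ≥0) (lam : ℝ)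
    (hK : LipschitzWith K φ) (hlam : 0 ≤ lam) (hconc : Adhesion.IsLambdaConcave lam φ) :
    -- the Lagrangian flow `X` is well defined
    (∃ X, Adhesion.IsAdhesionFlow φ X) ∧
    ∀ X, Adhesion.IsAdhesionFlow φ X → ∀ t : ℝ, 0 < t →
      -- `T_t` and `ρ_t` are well defined, and `w_t` is strictly convex
      Differentiable ℝ (Adhesion.psiConv φ t) ∧
      Measurable (X t) ∧
      StrictConvexOn ℝ univ (Adhesion.w φ t) ∧
      -- single-valued inverses and free streaming
      (∀ᵐ x : EuclideanSpace ℝ (Fin d), ∃ y ∈ Adhesion.Sigma φ t,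
        X t ⁻¹' {x} = {y} ∧ Adhesion.T φ t ⁻¹' {x} = {y} ∧
        DifferentiableAt ℝ φ y ∧
        ∀ s : ℝ, 0 ≤ s → s ≤ t →
          X s y = Adhesion.T φ s y ∧ Adhesion.T φ s y = y + s • ∇ φ y) ∧
      -- absolutely continuous parts and the Monge–Ampère equation
      ∃ μ : Measure (EuclideanSpace ℝ (Fin d)),
        Adhesion.IsMongeAmpereMeasure (Adhesion.w φ t) μ ∧
        (Adhesion.massMeasure X t).HaveLebesgueDecomposition volume ∧
        μ.HaveLebesgueDecomposition volume ∧
        Adhesion.acPart (Adhesion.massMeasure X t) = Adhesion.acPart μ ∧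
        ∀ᵐ x : EuclideanSpace ℝ (Fin d), ∃ H : Matrix (Fin d) (Fin d) ℝ,
          Adhesion.HasAlexandrovHessianAt (Adhesion.w φ t) H x ∧
          (Adhesion.massMeasure X t).rnDeriv volume x = ENNReal.ofReal H.det := by
  refine ⟨exists_isAdhesionFlow hK hlam hconc, fun X hX t ht => ?_⟩
  have hXc := (hX.lipschitzWith hK hlam hconc ht.le).continuous
  have hTc := (lipschitzWith_T ht.le hK hlam hconc).continuous
  have hfree := hX.ae_free_streaming hK hlam hconc ht
  have : SigmaFinite (massMeasure X t) := sigmaFinite_map_of_isProperMap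
    (isProperMap_of_norm_sub_le hXc (hX.norm_sub_le hK hlam hconc ht.le))
  have : SigmaFinite (Measure.map (T φ t) volume) :=
    sigmaFinite_map_of_isProperMap (isProperMap_T ht.le hK hlam hconc)
  have hac : (massMeasure X t).rnDeriv volume =ᵐ[volume]
      (Measure.map (T φ t) volume).rnDeriv volume := by
    refine rnDeriv_map_congr hXc.measurable hTc.measurable ?_
    filter_upwards [hfree] with x ⟨y, _, hXy, hTy, _⟩
    rw [hXy, hTy]
  refine ⟨fun y => (hasGradientAt_psiConv ht.le hK hlam hconc y).differentiableAt, hXc.measurable,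
    (strongConvexOn_w ht.le hK hlam hconc).strictConvexOn (by positivity), hfree,
    Measure.map (T φ t) volume, isMongeAmpereMeasure_map_T ht.le hK hlam hconc, inferInstance,
    inferInstance, withDensity_congr_ae hac, ?_⟩
  filter_upwards [hac, rnDeriv_map_T ht hK hlam hconc,
    ae_gradient_w_mem_regularSet ht hK hlam hconc] with x hx hTx hreg
  obtain ⟨H, hH, hdet⟩ := exists_hasAlexandrovHessianAt ht.le hK hlam hconc hreg.2
  rw [T_gradient_w ht.le hK hlam hconc hreg.1] at hH
  exact ⟨H, hH, by rw [hx, hTx, hdet]⟩
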